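/- Let $k$ be an integer with $1\le k\le 11$, put $e(w)=e^{2\pi i w}$, $\alpha=k/12$, $\xi=e(k/12)$, $D=k/\gcd(12,k)$ and $\chi_k(d)=i^{k(d-1)}$. Let $v=v_\eta^{2k}$ be the multiplier system of weight $k$ on $SL(2,\mathbb Z)$ given by the $2k$-th power of the multiplier system $v_\eta$ of the Dedekind eta function, so that $v\begin{pmatrix}1&1\\0&1\end{pmatrix}=\xi$. Let $R\in\mathbb R$ with $\lambda=\frac14+R^2>\frac14$. Let $\mathcal M(\Gamma,v,k,R)$ be the space of Maass waveforms: smooth functions $f$ on the upper half-plane $\mathbb H$ with $e^{-ik\operatorname{Arg}(cz+d)}f\left(\frac{az+b}{cz+d}\right)=v(A)f(z)$ for all $A=\begin{pmatrix}a&b\\c&d\end{pmatrix}\in SL(2,\mathbb Z)$, with $(\Delta_k+\lambda)f=0$, where $\Delta_k=y^2\left(\frac{\partial^2}{\partial x^2}+\frac{\partial^2}{\partial y^2}\right)-iky\frac{\partial}{\partial x}$, and with $\int_{SL(2,\mathbb Z)\backslash\mathbb H}|f|^2\,\frac{dx\,dy}{y^2}<\infty$. We say that $f$ has Fourier coefficients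 $c(n)$, $n\in\mathbb Z$, if $f(z)=\sum_{n\in\mathbb Z}c(n)\mathcal W_{n,k,R}(z)$ for all $z=x+iy\in\mathbb H$, where $$\mathcal W_{n,k,R}(z)=\frac{1}{\sqrt{|n+\alpha|}}\,W_{\frac k2\operatorname{sgn}(n+\alpha),\,iR}\left(4\pi|n+\alpha|y\right)e\left((n+\alpha)x\right)$$ and $W_{\kappa,\mu}$ is the Whittaker $W$-function. We set $c(x)=0$ for rational $x\notin\mathbb Z$. Let $m$ be a positive integer with $km\equiv k\pmod{12}$. Then a linear operator $T_m:\mathcal M(\Gamma,v,k,R)\to\mathcal M(\Gamma,v,k,R)$ is well defined by $$T_mf(z)=\frac1{\sqrt m}\sum_{ad=m,\ d>0}\chi_k(d)\sum_{b\bmod d}\xi^{-bd}f\left(\frac{az+b}{d}\right),$$ where each term of the inner sum depends only on $b$ modulo $d$. If $f\in\mathcal M(\Gamma,v,k,R)$ has Fourier coefficients $c(n)$, then $T_mf$ has Fourier coefficients $$d(n)=\sum_{0<d\,\mid\,\left(m,\ n-\frac{k(m-1)}{12}\right)}\chi_k(d)\,c\left(\frac{nm}{d^2}+\frac{k(m-d^2)}{12d^2}\right).$$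 If moreover $T_mf=\lambda_m f$ with $\lambda_m\in\mathbb C$ and $c(0)\ne0$, then $$\lambda_m=\frac1{c(0)}\begin{cases}c\left(\frac{k(m-1)}{12}\right),&(D,m)=1,\\[2pt] c\left(\frac{k(m-1)}{12}\right)+\chi_k(D)\,c\left(\frac{k(m-D^2)}{12D^2}\right),&(D,m)>1.\end{cases}$$ -/

import Mathlib

open UpperHalfPlane MeasureTheory
open scoped MatrixGroups Modular ContDiff

noncomputable section

namespace MaassHecke

/-- The slash action of weight `k` on functions on the upper half-plane:
`f|[k,g](z) = exp(-i k Arg(cz+d)) f(gz)`. -/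
def slash (k : ℕ) (g : SL(2, ℤ)) (f : ℍ → ℂ) (z : ℍ) : ℂ :=
  Complex.exp (-(Complex.I * k * Complex.arg (denom g z))) * f (g • z)

/-- The multiplier system of the Dedekind eta function, of weight `1/2`:
`η(gz) = v_η(g) (cz+d)^{1/2} η(z)` with the principal branch of the square root.
The quotient does not depend on `z`; it is evaluated at `z = i`. -/
def etaMult (g : SL(2, ℤ)) : ℂ :=
  ModularForm.eta ((g • I : ℍ) : ℂ) /
    ((denom g I) ^ (1 / 2 : ℂ) * ModularForm.eta ((I : ℍ) : ℂ))

/-- The multiplier system `v = v_η^{2k}` of weight `k`. -/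
def mult (k : ℕ) (g : SL(2, ℤ)) : ℂ := etaMult g ^ (2 * k)

/-- The weight `k` Laplacian `Δ_k = y² (∂²/∂x² + ∂²/∂y²) - i k y ∂/∂x`. -/
def laplace (k : ℕ) (f : ℍ → ℂ) (z : ℍ) : ℂ :=
  (z.im : ℂ) ^ 2 * Laplacian.laplacian (f ∘ ofComplex) (z : ℂ)
    - Complex.I * k * z.im * fderiv ℝ (f ∘ ofComplex) (z : ℂ) 1

/-- The space of Maass waveforms on the modular group of weight `k`, multiplier system
`v = v_η^{2k}` and spectral parameter `R`: smooth functions `f` on the upper half-plane with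
`f|[k,A] = v(A) f`, `(Δ_k + 1/4 + R²) f = 0`, which are square integrable over the standard
fundamental domain with respect to the hyperbolic measure `dx dy / y²` (this is `volume` on `ℍ`). -/
def maassSpace (k : ℕ) (R : ℝ) : Submodule ℂ (ℍ → ℂ) where
  carrier := {f | ContDiffOn ℝ ∞ (f ∘ ofComplex) {z : ℂ | 0 < z.im} ∧
    (∀ (A : SL(2, ℤ)) (z : ℍ), slash k A f z = mult k A * f z) ∧
    (∀ z : ℍ, laplace k f z + ((1 / 4 + R ^ 2 : ℝ) : ℂ) * f z = 0) ∧
    MemLp f 2 (volume.restrict 𝒟)}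
  zero_mem' := by
    have h0 : ((0 : ℍ → ℂ) ∘ ofComplex) = fun _ => (0 : ℂ) := rfl
    refine ⟨?_, ?_, ?_, MemLp.zero⟩
    · rw [h0]; exact contDiffOn_const
    · intro A z; simp [slash]
    · intro z
      simp only [laplace, h0, InnerProductSpace.laplacian_const]
      simp
  add_mem' := by
    rintro f g ⟨hf1, hf2, hf3, hf4⟩ ⟨hg1, hg2, hg3, hg4⟩
    have ho : IsOpen {z : ℂ | 0 < z.im} := isOpen_lt continuous_const Complex.continuous_im
    have hc : ((f + g) ∘ ofComplex) = f ∘ ofComplex + g ∘ ofComplex := rfl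
    refine ⟨?_, ?_, ?_, hf4.add hg4⟩
    · rw [hc]; exact hf1.add hg1
    · intro A z
      have h1 := hf2 A z
      have h2 := hg2 A z
      simp only [slash, Pi.add_apply] at *
      rw [mul_add, mul_add, h1, h2]
    · intro z
      have hz : {z : ℂ | 0 < z.im} ∈ nhds (z : ℂ) := ho.mem_nhds z.im_pos
      have cf := hf1.contDiffAt hz
      have cg := hg1.contDiffAt hz
      have h1 := hf3 z
      have h2 := hg3 z
      simp only [laplace, hc] at *
      rw [ContDiffAt.laplacian_add (cf.of_le (ENat.LEInfty.out))
        (cg.of_le (ENat.LEInfty.out)),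
        fderiv_add (cf.differentiableAt (by simp)) (cg.differentiableAt (by simp))]
      simp only [Pi.add_apply, add_apply]
      linear_combination h1 + h2
  smul_mem' := by
    rintro a f ⟨hf1, hf2, hf3, hf4⟩
    have ho : IsOpen {z : ℂ | 0 < z.im} := isOpen_lt continuous_const Complex.continuous_im
    have hc : ((a • f) ∘ ofComplex) = a • (f ∘ ofComplex) := rfl
    refine ⟨?_, ?_, ?_, hf4.const_smul a⟩
    · rw [hc]; exact contDiffOn_const.smul hf1
    · intro A z
      have h1 := hf2 A z
      simp only [slash, Pi.smul_apply, smul_eq_mul] at *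
      linear_combination a * h1
    · intro z
      have hz : {z : ℂ | 0 < z.im} ∈ nhds (z : ℂ) := ho.mem_nhds z.im_pos
      have cf := hf1.contDiffAt hz
      have h1 := hf3 z
      simp only [laplace, hc] at *
      rw [InnerProductSpace.laplacian_smul a (cf.of_le (ENat.LEInfty.out)),
        fderiv_const_smul (cf.differentiableAt (by simp))]
      simp only [Pi.smul_apply, smul_apply, smul_eq_mul]
      linear_combination a * h1

/-- Kummer's confluent hypergeometric function `₁F₁(a; c; x) = ∑ (a)_n / (c)_n x^n / n!`. -/
def kummer (a c : ℂ) (x : ℝ) : ℂ :=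
  ∑' n : ℕ, (ascPochhammer ℂ n).eval a / (ascPochhammer ℂ n).eval c * (x : ℂ) ^ n /
    (n.factorial : ℂ)

/-- The Whittaker function `M_{κ,μ}(y)`, for `y > 0` and `2μ` not a negative integer. -/
def whittakerM (κ μ : ℂ) (y : ℝ) : ℂ :=
  Complex.exp (-(y : ℂ) / 2) * (y : ℂ) ^ (μ + 1 / 2) * kummer (μ - κ + 1 / 2) (2 * μ + 1) y

/-- The Whittaker function `W_{κ,μ}(y)`, for `y > 0` and `2μ` not an integer. -/
def whittakerW (κ μ : ℂ) (y : ℝ) : ℂ :=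
  Complex.Gamma (-(2 * μ)) / Complex.Gamma (1 / 2 - μ - κ) * whittakerM κ μ y +
    Complex.Gamma (2 * μ) / Complex.Gamma (1 / 2 + μ - κ) * whittakerM κ (-μ) y

/-- The function `𝒲_{n,k,R}(x + iy) =
|n+α|^{-1/2} W_{(k/2) sgn(n+α), iR}(4π|n+α|y) e((n+α)x)` with `α = k/12`. -/
def fourierW (n : ℤ) (k : ℕ) (R : ℝ) (z : ℍ) : ℂ :=
  let s : ℝ := n + k / 12
  1 / (Real.sqrt |s| : ℂ) *
    whittakerW (((k : ℝ) / 2 * Real.sign s : ℝ) : ℂ) (Complex.I * R) (4 * Real.pi * |s| * z.im) *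
    Complex.exp (2 * Real.pi * Complex.I * s * z.re)

/-- `f` has the Fourier expansion `f(z) = ∑_{n ∈ ℤ} c(n) 𝒲_{n,k,R}(z)`. -/
def HasFourierCoeffs (k : ℕ) (R : ℝ) (f : ℍ → ℂ) (c : ℤ → ℂ) : Prop :=
  ∀ z : ℍ, HasSum (fun n : ℤ => c n * fourierW n k R z) (f z)

/-- `ξ = v(T) = e(k/12)`. -/
def xi (k : ℕ) : ℂ := Complex.exp (2 * Real.pi * Complex.I * (k / 12))

/-- `χ_k(d) = i^{k(d-1)}`. -/
def chi (k d : ℕ) : ℂ := Complex.I ^ ((k : ℤ) * ((d : ℤ) - 1))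

/-- The term `ξ^{-bd} f((az+b)/d)`, for positive integers `a`, `d`. -/
def heckeTerm (k : ℕ) (f : ℍ → ℂ) (a d : ℕ) (b : ℤ) (z : ℍ) : ℂ :=
  xi k ^ (-(b * d)) * f (ofComplex ((a * (z : ℂ) + b) / d))

/-- `T_m f(z) = m^{-1/2} ∑_{ad=m, d>0} χ_k(d) ∑_{b mod d} ξ^{-bd} f((az+b)/d)`. -/
def heckeOp (k m : ℕ) (f : ℍ → ℂ) (z : ℍ) : ℂ :=
  1 / (Real.sqrt m : ℂ) * ∑ p ∈ m.divisorsAntidiagonal,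
    chi k p.2 * ∑ b ∈ Finset.range p.2, heckeTerm k f p.1 p.2 b z

/-- The value `c(x)`, where `c(x) = 0` if `x` is not an integer. -/
def coeffAt (c : ℤ → ℂ) (x : ℚ) : ℂ := if x.den = 1 then c x.num else 0

/-- `d(n) = ∑_{0 < d ∣ (m, n - k(m-1)/12)} χ_k(d) c(nm/d² + k(m-d²)/(12d²))`, for positive `m`
with `km ≡ k mod 12` (so that the integer division by `12` is exact). -/
def heckeCoeff (k m : ℕ) (c : ℤ → ℂ) (n : ℤ) : ℂ :=
  ∑ d ∈ (Int.gcd (m : ℤ) (n - (k : ℤ) * ((m : ℤ) - 1) / 12)).divisors,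
    chi k d * coeffAt c ((n : ℚ) * m / (d : ℚ) ^ 2 + (k : ℚ) * (m - (d : ℚ) ^ 2) / (12 * (d : ℚ) ^ 2))

/-- `D = k / (12, k)`. -/
def bigD (k : ℕ) : ℕ := k / Nat.gcd 12 k

end MaassHecke

end

/-! The operator `T_m` is a sum over `SL(2, ℤ) \ Δ_m`, where `Δ_m` is the set of integral matrices
of determinant `m`. The weight is an integer, so the slash action is a genuine action and `v`
behaves as a character, with `v(T) = ξ` and `v(S) = ξ⁻³`. An explicit integer polynomial `psi` in
the matrix entries extends it by `v(M) = ξ ^ psi(M)`. The congruence `km ≡ k (mod 12)` is what makes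
`psi` change correctly, modulo `12/gcd(12,k)`, when `M ∈ Δ_m` is multiplied by `S` or `T` on either
side (`matPsi_dvd`). Hence `v(M)⁻¹ f|M` depends only on the left coset of `M` (`twist_smul`), and
right multiplication permutes the cosets (`slash_sum_twist`). On upper triangular representatives
this sum is exactly `T_m` (`heckeOp_eq_sum_twist`).

The affine maps `z ↦ (az+b)/d` commute with `Δ_k` and send the cusp region of `𝒟` into a strip
covered by finitely many translates of `𝒟`. So the eigenvalue equation and square integrability
survive (`heckeOp_mem`).

For the coefficients, an affine map rescales the frequency of a Whittaker wave by `a/d`, and the sum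
over `b` is a geometric sum of `d`-th roots of unity, which keeps one residue class of `n` modulo
`d` (`hasSum_sum_heckeTerm`).

For the eigenvalue, the coefficient at `0` is unique, because `W_{κ,iR}` is not identically zero for
`R ≠ 0` (`zero_coeff_eq`); so `d(0) = λ_m c(0)`. Since `D` is `1` or a prime and `gcd(m, k(m-1)/12)
= gcd(D, m)`, the sum for `d(0)` has one or two terms. -/

namespace MaassHecke

/-! ### The character modulo 12 on integral matrices -/

/-- The polynomial whose values modulo `12` on `SL(2, ℤ)` give the additive character
with value `1` at `T` and `-3` at `S`. -/
def psi {R : Type*} [CommRing R] (a b c d : R) : R :=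
  (1 - c ^ 2) * (b * d + 3 * (c - 1) * d + c + 3) + c * (a + d - 3)

lemma map_psi {R S : Type*} [CommRing R] [CommRing S] (φ : R →+* S) (a b c d : R) :
    φ (psi a b c d) = psi (φ a) (φ b) (φ c) (φ d) := by
  simp [psi, map_ofNat φ 3]

-- A finite check. Splitting `12 = 3 · 4` leaves `3⁵` and `4⁵` residue tuples in place of `12⁵`.
set_option maxRecDepth 100000 in
lemma psi_zmod_three : ∀ k a b c d : ZMod 3, k * (a * d - b * c) = k →
    k * (psi (a + c) (b + d) c d - psi a b c d - 1) = 0 ∧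
    k * (psi (-c) (-d) a b - psi a b c d + 3) = 0 ∧
    k * (psi a (a + b) c (c + d) - psi a b c d - 1) = 0 ∧
    k * (psi b (-a) d (-c) - psi a b c d + 3) = 0 := by
  unfold psi
  decide +kernel

set_option maxRecDepth 100000 in
lemma psi_zmod_four : ∀ k a b c d : ZMod 4, k * (a * d - b * c) = k →
    k * (psi (a + c) (b + d) c d - psi a b c d - 1) = 0 ∧
    k * (psi (-c) (-d) a b - psi a b c d + 3) = 0 ∧
    k * (psi a (a + b) c (c + d) - psi a b c d - 1) = 0 ∧
    k * (psi b (-a) d (-c) - psi a b c d + 3) = 0 := by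
  unfold psi
  decide +kernel

lemma twelve_dvd_of_zmod {x : ℤ} (h3 : (x : ZMod 3) = 0) (h4 : (x : ZMod 4) = 0) : 12 ∣ x := by
  have h3' := (ZMod.intCast_zmod_eq_zero_iff_dvd x 3).1 h3
  have h4' := (ZMod.intCast_zmod_eq_zero_iff_dvd x 4).1 h4
  omega

lemma psi_int {k a b c d : ℤ} (h : 12 ∣ k * (a * d - b * c) - k) :
    12 ∣ k * (psi (a + c) (b + d) c d - psi a b c d - 1) ∧
    12 ∣ k * (psi (-c) (-d) a b - psi a b c d + 3) ∧
    12 ∣ k * (psi a (a + b) c (c + d) - psi a b c d - 1) ∧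
    12 ∣ k * (psi b (-a) d (-c) - psi a b c d + 3) := by
  have h3 : (k : ZMod 3) * (a * d - b * c) = k := by
    have h' : (3 : ℤ) ∣ k * (a * d - b * c) - k := by omega
    have := (ZMod.intCast_zmod_eq_zero_iff_dvd _ 3).2 h'
    push_cast at this
    exact sub_eq_zero.1 this
  have h4 : (k : ZMod 4) * (a * d - b * c) = k := by
    have h' : (4 : ℤ) ∣ k * (a * d - b * c) - k := by omega
    have := (ZMod.intCast_zmod_eq_zero_iff_dvd _ 4).2 h'
    push_cast at this
    exact sub_eq_zero.1 this
  have e3 := psi_zmod_three k a b c d h3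
  have e4 := psi_zmod_four k a b c d h4
  have c3 := fun x y z w : ℤ ↦ map_psi (Int.castRingHom (ZMod 3)) x y z w
  have c4 := fun x y z w : ℤ ↦ map_psi (Int.castRingHom (ZMod 4)) x y z w
  simp only [eq_intCast] at c3 c4
  refine ⟨twelve_dvd_of_zmod ?_ ?_, twelve_dvd_of_zmod ?_ ?_, twelve_dvd_of_zmod ?_ ?_,
    twelve_dvd_of_zmod ?_ ?_⟩ <;> push_cast [c3, c4]
  exacts [e3.1, e4.1, e3.2.1, e4.2.1, e3.2.2.1, e4.2.2.1, e3.2.2.2, e4.2.2.2]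

/-! ### The slash action of integral weight -/

/-- `(cz+d)`-factor of integral weight: `w ↦ exp(-i k arg w)`. -/
noncomputable def argFactor (k : ℕ) (w : ℂ) : ℂ := Complex.exp (-(Complex.I * k * Complex.arg w))

/-- Integrality of `k` removes the branch of `Arg`: the factor is multiplicative in `w`, so no
cocycle appears in the composition of slashes. -/
lemma argFactor_eq (k : ℕ) {w : ℂ} (hw : w ≠ 0) : argFactor k w = (‖w‖ / w) ^ k := by
  have h : (‖w‖ : ℂ) / w = Complex.exp (-(Complex.I * Complex.arg w)) := by
    have hn : (‖w‖ : ℂ) ≠ 0 := by simpa using hw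
    rw [div_eq_iff hw]
    conv_lhs => rw [← mul_one (‖w‖ : ℂ)]
    conv_rhs => rw [mul_comm, ← Complex.norm_mul_exp_arg_mul_I w]
    rw [Complex.norm_mul_exp_arg_mul_I w]
    nth_rw 2 [← Complex.norm_mul_exp_arg_mul_I w]
    rw [mul_assoc, ← Complex.exp_add]
    ring_nf
    simp
  rw [h, ← Complex.exp_nat_mul, argFactor]
  congr 1
  ring

lemma argFactor_mul (k : ℕ) {w w' : ℂ} (hw : w ≠ 0) (hw' : w' ≠ 0) :
    argFactor k (w * w') = argFactor k w * argFactor k w' := by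
  rw [argFactor_eq k hw, argFactor_eq k hw', argFactor_eq k (mul_ne_zero hw hw'), ← mul_pow]
  simp only [norm_mul, Complex.ofReal_mul]
  congr 1
  field_simp

lemma argFactor_of_pos (k : ℕ) {x : ℝ} (hx : 0 < x) : argFactor k x = 1 := by
  simp [argFactor, Complex.arg_ofReal_of_nonneg hx.le]

/-- The weight `k` slash action of real matrices. -/
noncomputable def slashGL (k : ℕ) (g : GL (Fin 2) ℝ) (f : ℍ → ℂ) (z : ℍ) : ℂ :=
  argFactor k (denom g z) * f (g • z)

lemma slash_eq_slashGL (k : ℕ) (g : SL(2, ℤ)) (f : ℍ → ℂ) (z : ℍ) :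
    slash k g f z = slashGL k (g : GL (Fin 2) ℝ) f z := rfl

lemma slashGL_mul (k : ℕ) (g h : GL (Fin 2) ℝ) (hh : 0 < h.det.val) (f : ℍ → ℂ) (z : ℍ) :
    slashGL k (g * h) f z = argFactor k (denom h z) * slashGL k g f (h • z) := by
  have e : denom (g * h) z = denom g ((h • z : ℍ) : ℂ) * denom h z := by
    rw [denom_cocycle_σ g h z, σ, if_pos hh]
    rfl
  rw [slashGL, slashGL, e, argFactor_mul k (denom_ne_zero _ _) (denom_ne_zero _ _), mul_smul]
  ring

lemma slash_mul (k : ℕ) (g h : SL(2, ℤ)) (f : ℍ → ℂ) (z : ℍ) :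
    slash k (g * h) f z = slash k h (slash k g f) z := by
  have := slashGL_mul k (g : GL (Fin 2) ℝ) (h : GL (Fin 2) ℝ) (by simp) f z
  rw [slash_eq_slashGL, map_mul, map_mul, this]
  rfl

end MaassHecke

/-! ### Cosets of determinant `m` matrices and the twisted sum -/

noncomputable section

namespace MaassHecke

open FixedDetMatrices ModularGroup

lemma xi_ne_zero (k : ℕ) : xi k ≠ 0 := Complex.exp_ne_zero _

lemma xi_zpow (k : ℕ) (x : ℤ) :
    xi k ^ x = Complex.exp (2 * Real.pi * Complex.I * ((k * x : ℤ) / 12)) := by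
  rw [xi, ← Complex.exp_int_mul]
  congr 1
  push_cast
  ring

lemma xi_zpow_eq_one {k : ℕ} {x : ℤ} (h : (12 : ℤ) ∣ k * x) : xi k ^ x = 1 := by
  obtain ⟨t, ht⟩ := h
  rw [xi_zpow, ht, Complex.exp_eq_one_iff]
  exact ⟨t, by push_cast; ring⟩

lemma xi_zpow_congr {k : ℕ} {x y : ℤ} (h : (12 : ℤ) ∣ k * (x - y)) : xi k ^ x = xi k ^ y := by
  have := xi_zpow_eq_one h
  rwa [zpow_sub₀ (xi_ne_zero k), div_eq_one_iff_eq (zpow_ne_zero _ (xi_ne_zero k))] at this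

lemma chi_eq_xi_zpow (k d : ℕ) : chi k d = xi k ^ (3 * ((d : ℤ) - 1)) := by
  have h : xi k ^ (3 : ℤ) = Complex.I ^ (k : ℤ) := by
    have hI : Complex.I ^ k = Complex.exp (k * (Real.pi / 2 * Complex.I)) := by
      rw [Complex.exp_nat_mul, Complex.exp_pi_div_two_mul_I]
    rw [xi_zpow, zpow_natCast, hI]
    congr 1
    push_cast
    ring
  rw [zpow_mul, h, chi, zpow_mul]

section FixedDet

variable {m : ℤ}

/-- An integral matrix of determinant `m > 0` as an element of `GL(2, ℝ)`. -/
def realGL (hm : 0 < m) (M : FixedDetMatrix (Fin 2) ℤ m) : GL (Fin 2) ℝ :=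
  Matrix.GeneralLinearGroup.mkOfDetNeZero (M.1.map (Int.castRingHom ℝ)) (by
    rw [← RingHom.mapMatrix_apply, ← RingHom.map_det, M.2]
    simpa using hm.ne')

lemma realGL_apply (hm : 0 < m) (M : FixedDetMatrix (Fin 2) ℤ m) (i j : Fin 2) :
    realGL hm M i j = M.1 i j := rfl

lemma det_realGL (hm : 0 < m) (M : FixedDetMatrix (Fin 2) ℤ m) :
    (realGL hm M).det.val = m := by
  change (M.1.map (Int.castRingHom ℝ)).det = m
  rw [← RingHom.mapMatrix_apply, ← RingHom.map_det, M.2]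
  simp

lemma realGL_smul (hm : 0 < m) (A : SL(2, ℤ)) (M : FixedDetMatrix (Fin 2) ℤ m) :
    realGL hm (A • M) = (A : GL (Fin 2) ℝ) * realGL hm M := by
  ext i j
  change (((A • M).1 i j : ℤ) : ℝ) = _
  rw [smul_coe, Units.val_mul, Matrix.mul_apply, Matrix.mul_apply]
  push_cast
  rfl

/-- Right multiplication by `SL(2, ℤ)` on matrices of determinant `m`. -/
def mulRight (M : FixedDetMatrix (Fin 2) ℤ m) (A : SL(2, ℤ)) : FixedDetMatrix (Fin 2) ℤ m :=
  ⟨M.1 * A.1, by rw [Matrix.det_mul, M.2, A.2, mul_one]⟩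

lemma realGL_mulRight (hm : 0 < m) (A : SL(2, ℤ)) (M : FixedDetMatrix (Fin 2) ℤ m) :
    realGL hm (mulRight M A) = realGL hm M * (A : GL (Fin 2) ℝ) := by
  ext i j
  change (((M.1 * A.1) i j : ℤ) : ℝ) = _
  rw [Units.val_mul, Matrix.mul_apply, Matrix.mul_apply]
  push_cast
  rfl

lemma smul_mulRight (A B : SL(2, ℤ)) (M : FixedDetMatrix (Fin 2) ℤ m) :
    A • mulRight M B = mulRight (A • M) B := by
  apply FixedDetMatrices.ext'
  rw [smul_coe]
  simp only [mulRight, smul_coe, mul_assoc]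

lemma mulRight_mul (A B : SL(2, ℤ)) (M : FixedDetMatrix (Fin 2) ℤ m) :
    mulRight (mulRight M A) B = mulRight M (A * B) := by
  apply FixedDetMatrices.ext'
  simp only [mulRight, mul_assoc, Matrix.SpecialLinearGroup.coe_mul]

lemma mulRight_one (M : FixedDetMatrix (Fin 2) ℤ m) : mulRight M 1 = M := by
  apply FixedDetMatrices.ext'
  simp [mulRight]

lemma exists_smul_eq_reduce (A : FixedDetMatrix (Fin 2) ℤ m) :
    ∃ B : SL(2, ℤ), B • A = reduce A := by
  induction A using reduce_rec with
  | base A h =>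
    by_cases h1 : 0 < A.1 0 0
    · exact ⟨_, (reduce_of_pos h h1).symm⟩
    · rw [reduce_of_not_pos h h1]
      exact ⟨T ^ (-(-A.1 0 1 / -A.1 1 1)) * (S * S), by rw [mul_smul, mul_smul]⟩
  | step A h ih =>
    obtain ⟨B, hB⟩ := ih
    rw [reduce_reduceStep h] at hB
    exact ⟨B * (S * T ^ (-(A.1 0 0 / A.1 1 0))), by rw [← hB, mul_smul, mul_smul]; rfl⟩

lemma det_of_mem_reps {M : FixedDetMatrix (Fin 2) ℤ m} (h : M ∈ reps m) :
    M.1 0 0 * M.1 1 1 = m := by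
  have := M.2
  rwa [Matrix.det_fin_two, h.1, mul_zero, sub_zero] at this

lemma pos_of_mem_reps (hm : 0 < m) {M : FixedDetMatrix (Fin 2) ℤ m} (h : M ∈ reps m) :
    0 < M.1 1 1 :=
  pos_of_mul_pos_right (hm.trans_eq (det_of_mem_reps h).symm) h.2.1.le

/-- The zero lower left entries and the positive diagonals force `B` to be a power of `T`. The
bounds `0 ≤ b < d` on the upper right entries then force the exponent to be `0`. -/
lemma reps_unique (hm : 0 < m) {M M' : FixedDetMatrix (Fin 2) ℤ m} (h : M ∈ reps m)
    (h' : M' ∈ reps m) (B : SL(2, ℤ)) (hB : B • M = M') : M = M' := by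
  have e (i j : Fin 2) : M'.1 i j = B.1 i 0 * M.1 0 j + B.1 i 1 * M.1 1 j := by
    rw [← hB, smul_coe, Matrix.mul_apply, Fin.sum_univ_two]
  have hd := pos_of_mem_reps hm h
  have hd' := pos_of_mem_reps hm h'
  obtain ⟨h10, h00, h01, h11⟩ := h
  obtain ⟨h10', h00', h01', h11'⟩ := h'
  have hdet : B.1 0 0 * B.1 1 1 - B.1 0 1 * B.1 1 0 = 1 := by
    rw [← Matrix.det_fin_two]; exact B.2
  have e00 := e 0 0
  have e01 := e 0 1
  have e10 := e 1 0
  have e11 := e 1 1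
  rw [h10] at e00 e10
  rw [h10', mul_zero, add_zero] at e10
  have hr : B.1 1 0 = 0 := by
    rcases mul_eq_zero.1 e10.symm with h | h
    · exact h
    · omega
  rw [mul_zero, add_zero] at e00
  have hp : 0 < B.1 0 0 := pos_of_mul_pos_left (h00'.trans_eq e00) h00.le
  rw [hr, mul_zero, sub_zero] at hdet
  have hp1 : B.1 0 0 = 1 := by
    rcases Int.mul_eq_one_iff_eq_one_or_neg_one.1 hdet with h | h <;> omega
  have hs1 : B.1 1 1 = 1 := by simpa [hp1] using hdet
  rw [hr, hs1, zero_mul, zero_add, one_mul] at e11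
  rw [hp1, one_mul] at e01 e00
  rw [abs_of_nonneg h01, abs_of_pos hd] at h11
  rw [abs_of_nonneg h01', abs_of_pos hd'] at h11'
  have hq : B.1 0 1 = 0 := by
    rw [e11, e01] at h11'
    rw [e01] at h01'
    have h1 : B.1 0 1 < 1 := by nlinarith
    have h2 : -1 < B.1 0 1 := by nlinarith
    omega
  rw [hq, zero_mul, add_zero] at e01
  ext i j
  fin_cases i <;> fin_cases j
  · exact e00.symm
  · exact e01.symm
  · exact h10.trans h10'.symm
  · exact e11.symm

/-- The self-map of the representatives of `SL(2, ℤ) \ Δ_m` induced by right multiplication. -/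
def repsMap (hm : 0 < m) (A : SL(2, ℤ)) (M : reps m) : reps m :=
  ⟨reduce (mulRight M.1 A), reduce_mem_reps hm.ne' _⟩

lemma repsMap_bijective (hm : 0 < m) (A : SL(2, ℤ)) : Function.Bijective (repsMap hm A) := by
  refine (Finite.injective_iff_bijective).1 fun M M' h ↦ ?_
  obtain ⟨B, hB⟩ := exists_smul_eq_reduce (mulRight M.1 A)
  obtain ⟨B', hB'⟩ := exists_smul_eq_reduce (mulRight M'.1 A)
  have h1 : B • mulRight M.1 A = B' • mulRight M'.1 A := by
    rw [hB, hB']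
    exact congrArg Subtype.val h
  have h2 : (B'⁻¹ * B) • M.1 = M'.1 := by
    rw [smul_mulRight, smul_mulRight] at h1
    have h3 := congrArg (fun X ↦ mulRight X A⁻¹) h1
    simp only [mulRight_mul, mul_inv_cancel, mulRight_one] at h3
    rw [mul_smul, h3, inv_smul_smul]
  exact Subtype.ext (reps_unique hm M.2 M'.2 _ h2)

/-- The exponent `psi` of an integral matrix. -/
def matPsi (M : FixedDetMatrix (Fin 2) ℤ m) : ℤ :=
  psi (M.1 0 0) (M.1 0 1) (M.1 1 0) (M.1 1 1)

lemma matPsi_dvd {k : ℤ} (hkm : 12 ∣ k * m - k) (M : FixedDetMatrix (Fin 2) ℤ m) :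
    12 ∣ k * (matPsi (T • M) - matPsi M - 1) ∧
    12 ∣ k * (matPsi (S • M) - matPsi M + 3) ∧
    12 ∣ k * (matPsi (mulRight M T) - matPsi M - 1) ∧
    12 ∣ k * (matPsi (mulRight M S) - matPsi M + 3) := by
  have hdet := M.2
  rw [Matrix.det_fin_two] at hdet
  rw [← hdet] at hkm
  have := psi_int hkm
  simp only [matPsi, smul_coe]
  simpa [mulRight, T, S, Matrix.mul_apply, Fin.sum_univ_two] using this

/-- The twisted slash action `v(M)⁻¹ f|M` of an integral matrix of positive determinant. -/
def twist (k : ℕ) (f : ℍ → ℂ) (hm : 0 < m) (M : FixedDetMatrix (Fin 2) ℤ m) (z : ℍ) : ℂ :=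
  xi k ^ (-matPsi M) * slashGL k (realGL hm M) f z

/-- Well-definedness on left cosets. It suffices to treat the generators `S` and `T`, where the
factor from the automorphy of `f` cancels the change of `psi`. -/
lemma twist_smul (k : ℕ) {f : ℍ → ℂ} (hT : ∀ z, slash k T f z = xi k * f z)
    (hS : ∀ z, slash k S f z = xi k ^ (-3 : ℤ) * f z) (hm : 0 < m)
    (hkm : (12 : ℤ) ∣ k * m - k) (A : SL(2, ℤ)) (M : FixedDetMatrix (Fin 2) ℤ m) (z : ℍ) :
    twist k f hm (A • M) z = twist k f hm M z := by
  have hdet : ∀ M, 0 < (realGL hm M).det.val := fun M ↦ by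
    rw [det_realGL]; exact_mod_cast hm
  have key (B : SL(2, ℤ)) (e : ℤ) (hB : ∀ z, slash k B f z = xi k ^ e * f z)
      (he : ∀ M : FixedDetMatrix (Fin 2) ℤ m, (12 : ℤ) ∣ k * (matPsi (B • M) - matPsi M - e))
      (M : FixedDetMatrix (Fin 2) ℤ m) : twist k f hm (B • M) z = twist k f hm M z := by
    rw [twist, realGL_smul, slashGL_mul k _ _ (hdet M), ← slash_eq_slashGL, hB, twist, slashGL]
    have : xi k ^ (-matPsi (B • M)) * xi k ^ e = xi k ^ (-matPsi M) := by
      rw [← zpow_add₀ (xi_ne_zero k)]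
      refine xi_zpow_congr ?_
      obtain ⟨t, ht⟩ := he M
      exact ⟨-t, by linear_combination -ht⟩
    rw [← this]
    ring
  have hmem : A ∈ Subgroup.closure {S, T} := by
    rw [SpecialLinearGroup.SL2Z_generators]; trivial
  induction hmem using Subgroup.closure_induction generalizing M with
  | mem B hB =>
    rcases hB with rfl | rfl
    · exact key S (-3) hS (fun M ↦ by simpa using (matPsi_dvd hkm M).2.1) M
    · exact key T 1 (by simpa using hT) (fun M ↦ (matPsi_dvd hkm M).1) M
  | one => rw [one_smul]
  | mul B C _ _ hB hC => rw [mul_smul, hB, hC]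
  | inv B _ hB => rw [← hB, smul_inv_smul]

lemma argFactor_mul_twist (k : ℕ) {f : ℍ → ℂ} (hm : 0 < m) (A : SL(2, ℤ)) (e : ℤ)
    (M : FixedDetMatrix (Fin 2) ℤ m) (he : (12 : ℤ) ∣ k * (matPsi (mulRight M A) - matPsi M - e))
    (z : ℍ) :
    argFactor k (denom A z) * twist k f hm M (A • z) = xi k ^ e * twist k f hm (mulRight M A) z := by
  rw [twist, twist, realGL_mulRight, slashGL_mul k _ _ (by simp)]
  have : xi k ^ e * xi k ^ (-matPsi (mulRight M A)) = xi k ^ (-matPsi M) := by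
    rw [← zpow_add₀ (xi_ne_zero k)]
    refine xi_zpow_congr ?_
    obtain ⟨t, ht⟩ := he
    exact ⟨-t, by linear_combination -ht⟩
  rw [← this, sl_moeb]
  ring

/-- Slashing by `A` replaces each `M` by `M A` at the cost of `ξ ^ e`. The map `M ↦ M A` permutes
the cosets, so the sum is reproduced. -/
lemma slash_sum_twist (k : ℕ) {f : ℍ → ℂ} (hT : ∀ z, slash k T f z = xi k * f z)
    (hS : ∀ z, slash k S f z = xi k ^ (-3 : ℤ) * f z) (hm : 0 < m)
    (hkm : (12 : ℤ) ∣ k * m - k) (A : SL(2, ℤ)) (e : ℤ)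
    (he : ∀ M : FixedDetMatrix (Fin 2) ℤ m,
      (12 : ℤ) ∣ k * (matPsi (mulRight M A) - matPsi M - e)) (z : ℍ) :
    slash k A (fun z ↦ ∑ M : reps m, twist k f hm M.1 z) z
      = xi k ^ e * ∑ M : reps m, twist k f hm M.1 z := by
  change argFactor k (denom A z) * ∑ M : reps m, twist k f hm M.1 (A • z) = _
  rw [Finset.mul_sum]
  simp only [fun M : reps m ↦ argFactor_mul_twist k (f := f) hm A e M.1 (he M.1) z]
  rw [← Finset.mul_sum]
  congr 1
  rw [← (repsMap_bijective hm A).sum_comp (fun M ↦ twist k f hm M.1 z)]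
  refine Finset.sum_congr rfl fun M _ ↦ ?_
  obtain ⟨B, hB⟩ := exists_smul_eq_reduce (mulRight M.1 A)
  change _ = twist k f hm (reduce (mulRight M.1 A)) z
  rw [← hB, twist_smul k hT hS hm hkm]

end FixedDet

/-- The point `(az+b)/d`. -/
def affinePt (a d : ℕ) (b : ℤ) (z : ℍ) : ℍ := ofComplex ((a * (z : ℂ) + b) / d)

lemma coe_affinePt {a d : ℕ} (ha : 0 < a) (hd : 0 < d) (b : ℤ) (z : ℍ) :
    (affinePt a d b z : ℂ) = (a * (z : ℂ) + b) / d := by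
  have : 0 < ((a * (z : ℂ) + b) / d).im := by
    rw [Complex.div_natCast_im]
    simp only [Complex.add_im, Complex.mul_im, Complex.natCast_re, Complex.natCast_im,
      Complex.intCast_im]
    have := z.im_pos
    simp only [coe_im, zero_mul, add_zero]
    positivity
  rw [affinePt, ofComplex_apply_of_im_pos this]

lemma slashGL_of_lower_zero (k : ℕ) (f : ℍ → ℂ) (g : GL (Fin 2) ℝ) {a d : ℕ} {b : ℤ} (ha : 0 < a)
    (hd : 0 < d) (h00 : g 0 0 = a) (h01 : g 0 1 = b) (h10 : g 1 0 = 0) (h11 : g 1 1 = d) (z : ℍ) :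
    slashGL k g f z = f (affinePt a d b z) := by
  have hdet : 0 < g.det.val := by
    change 0 < g.val.det
    rw [Matrix.det_fin_two, h00, h10, h11, mul_zero, sub_zero]
    positivity
  have h1 : denom g z = ((d : ℝ) : ℂ) := by simp [denom, h10, h11]
  rw [slashGL, h1, argFactor_of_pos k (by positivity), one_mul]
  congr 1
  ext
  rw [coe_affinePt ha hd, coe_smul_of_det_pos hdet, h1, num, h00, h01]
  simp

/-- At `c = 0` the exponent is `psi = bd - 3d + 3`. Since `ξ³ = i^k`, this gives `ξ ^ (-psi) =
χ_k(d) ξ ^ (-bd)`, the weight in the definition of `T_m`. -/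
lemma heckeOp_eq_sum_twist (k : ℕ) (f : ℍ → ℂ) {m : ℕ} (hm : 0 < (m : ℤ)) (z : ℍ) :
    heckeOp k m f z = 1 / (Real.sqrt m : ℂ) * ∑ M : reps (m : ℤ), twist k f hm M.1 z := by
  rw [heckeOp]
  congr 1
  simp only [Finset.mul_sum]
  rw [Finset.sum_sigma']
  symm
  have hcast {M : FixedDetMatrix (Fin 2) ℤ m} (h : M ∈ reps (m : ℤ)) :
      ((M.1 0 0).toNat : ℤ) = M.1 0 0 ∧ ((M.1 1 1).toNat : ℤ) = M.1 1 1 ∧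
      ((M.1 0 1).toNat : ℤ) = M.1 0 1 :=
    ⟨Int.toNat_of_nonneg h.2.1.le, Int.toNat_of_nonneg (pos_of_mem_reps hm h).le,
      Int.toNat_of_nonneg h.2.2.1⟩
  refine Finset.sum_bij (fun M _ ↦ ⟨((M.1.1 0 0).toNat, (M.1.1 1 1).toNat), (M.1.1 0 1).toNat⟩)
    ?_ ?_ ?_ ?_
  · rintro ⟨M, hM⟩ -
    obtain ⟨h1, h2, h3⟩ := hcast hM
    simp only [Finset.mem_sigma, Nat.mem_divisorsAntidiagonal, Finset.mem_range]
    refine ⟨⟨?_, by omega⟩, ?_⟩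
    · zify
      rw [h1, h2, det_of_mem_reps hM]
    · have := hM.2.2.2
      rw [abs_of_nonneg hM.2.2.1, abs_of_pos (pos_of_mem_reps hm hM)] at this
      omega
  · rintro ⟨M, hM⟩ - ⟨M', hM'⟩ - h
    obtain ⟨h1, h2, h3⟩ := hcast hM
    obtain ⟨h1', h2', h3'⟩ := hcast hM'
    simp only [Sigma.mk.injEq, Prod.mk.injEq, heq_eq_eq] at h
    obtain ⟨⟨e1, e2⟩, e3⟩ := h
    apply Subtype.ext
    change M = M'
    ext i j
    fin_cases i <;> fin_cases j
    · exact h1.symm.trans ((congrArg _ e1).trans h1')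
    · exact h3.symm.trans ((congrArg _ e3).trans h3')
    · exact hM.1.trans hM'.1.symm
    · exact h2.symm.trans ((congrArg _ e2).trans h2')
  · rintro ⟨⟨a, d⟩, b⟩ h
    simp only [Finset.mem_sigma, Nat.mem_divisorsAntidiagonal, Finset.mem_range] at h
    obtain ⟨⟨had, h0⟩, hb⟩ := h
    have ha : 0 < a := Nat.pos_of_ne_zero (by rintro rfl; simp at had; omega)
    refine ⟨⟨⟨!![(a : ℤ), b; 0, d], ?_⟩, ?_⟩, Finset.mem_univ _, ?_⟩
    · rw [Matrix.det_fin_two_of, ← had]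
      push_cast
      ring
    · refine ⟨rfl, by simpa using ha, by simp, by simpa using hb⟩
    · simp
  · rintro ⟨M, hM⟩ -
    obtain ⟨h1, h2, h3⟩ := hcast hM
    have hd := pos_of_mem_reps hm hM
    have ha := hM.2.1
    have hr := slashGL_of_lower_zero k f (realGL hm M) (a := (M.1 0 0).toNat)
      (d := (M.1 1 1).toNat) (b := ((M.1 0 1).toNat : ℤ)) (by omega) (by omega)
      (by rw [realGL_apply]; exact_mod_cast h1.symm) (by rw [realGL_apply]; exact_mod_cast h3.symm)
      (by rw [realGL_apply, hM.1]; simp) (by rw [realGL_apply]; exact_mod_cast h2.symm) z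
    change twist k f hm M z = chi k (M.1 1 1).toNat * (_ * f (affinePt _ _ _ z))
    rw [twist, hr, chi_eq_xi_zpow, ← mul_assoc, ← zpow_add₀ (xi_ne_zero k), matPsi, hM.1, h2, h3]
    congr 2
    simp only [psi]
    ring

end MaassHecke
end

/-! ### The eta multiplier and automorphy of `T_m f` -/

noncomputable section

namespace MaassHecke

open FixedDetMatrices ModularGroup

lemma eta_add_one (z : ℂ) :
    ModularForm.eta (z + 1) = Complex.exp (2 * Real.pi * Complex.I / 24) * ModularForm.eta z := by
  have h1 : Function.Periodic.qParam 1 (z + 1) = Function.Periodic.qParam 1 z := by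
    simp only [Function.Periodic.qParam, Complex.ofReal_one, div_one, mul_add, mul_one,
      Complex.exp_add, Complex.exp_two_pi_mul_I]
  have h2 : Function.Periodic.qParam 24 (z + 1)
      = Complex.exp (2 * Real.pi * Complex.I / 24) * Function.Periodic.qParam 24 z := by
    rw [Function.Periodic.qParam, Function.Periodic.qParam, ← Complex.exp_add]
    congr 1
    push_cast
    ring
  rw [ModularForm.eta, ModularForm.eta, h2, mul_assoc]
  simp only [ModularForm.eta_q, h1]

lemma mult_T (k : ℕ) : mult k T = xi k := by
  have hT : ((T • I : ℍ) : ℂ) = (I : ℍ) + 1 := by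
    rw [modular_T_smul]; simp [add_comm]
  have hd : denom T I = 1 := by rw [denom_apply]; simp [T]
  have h0 : ModularForm.eta ((I : ℍ) : ℂ) ≠ 0 := ModularForm.eta_ne_zero I.im_pos
  rw [mult, etaMult, hd, Complex.one_cpow, one_mul, hT, eta_add_one, mul_div_assoc, div_self h0,
    mul_one, ← Complex.exp_nat_mul, xi]
  congr 1
  push_cast
  ring

/-- Invariance under the slash action with the eta multiplier system. -/
def IsAutomorphic (k : ℕ) (f : ℍ → ℂ) : Prop :=
  ∀ (A : SL(2, ℤ)) (z : ℍ), slash k A f z = mult k A * f z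

lemma slash_mul_const (k : ℕ) (A : SL(2, ℤ)) (f : ℍ → ℂ) (a : ℂ) (z : ℍ) :
    slash k A (fun w ↦ a * f w) z = a * slash k A f z := by
  simp only [slash]
  ring

lemma slash_one (k : ℕ) (f : ℍ → ℂ) (z : ℍ) : slash k 1 f z = f z := by
  have : argFactor k 1 = 1 := by simpa using argFactor_of_pos k one_pos
  rw [slash_eq_slashGL, slashGL, map_one, map_one, denom_one, this, one_mul, one_smul]

namespace IsAutomorphic

variable {k : ℕ} {f : ℍ → ℂ}

lemma slash_mul_eq (hf : IsAutomorphic k f) (A B : SL(2, ℤ)) (z : ℍ) :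
    slash k (A * B) f z = mult k A * mult k B * f z := by
  rw [slash_mul, show slash k A f = fun w ↦ mult k A * f w from funext (hf A), slash_mul_const,
    hf B, mul_assoc]

/-- A nonzero automorphic `f` itself forces `v` to be a character, so of the transformation laws of
eta only the one under `z ↦ z + 1` is used. -/
lemma mult_mul (hf : IsAutomorphic k f) (h0 : f ≠ 0) (A B : SL(2, ℤ)) :
    mult k (A * B) = mult k A * mult k B := by
  obtain ⟨z, hz⟩ := Function.ne_iff.1 h0
  exact mul_right_cancel₀ hz ((hf _ z).symm.trans (hf.slash_mul_eq A B z))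

lemma mult_one (hf : IsAutomorphic k f) (h0 : f ≠ 0) : mult k 1 = 1 := by
  obtain ⟨z, hz⟩ := Function.ne_iff.1 h0
  exact mul_right_cancel₀ hz ((hf 1 z).symm.trans (by rw [slash_one, one_mul]))

lemma mult_ne_zero (hf : IsAutomorphic k f) (h0 : f ≠ 0) (A : SL(2, ℤ)) : mult k A ≠ 0 := by
  intro h
  have := hf.mult_mul h0 A A⁻¹
  rw [mul_inv_cancel, hf.mult_one h0, h, zero_mul] at this
  exact one_ne_zero this

/-- The relation `TSTST = S` gives `ξ³ v(S)² = v(S)`, and `v(S) ≠ 0`. -/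
lemma mult_S (hf : IsAutomorphic k f) (h0 : f ≠ 0) : mult k S = xi k ^ (-3 : ℤ) := by
  have hrel : T * S * T * S * T = S := by
    apply Subtype.ext
    simp only [Matrix.SpecialLinearGroup.coe_mul]
    decide
  have h := congrArg (mult k) hrel
  simp only [hf.mult_mul h0, mult_T] at h
  have h1 : mult k S * xi k ^ (3 : ℤ) = 1 := by
    refine mul_left_cancel₀ (hf.mult_ne_zero h0 S) ?_
    rw [mul_one]
    nth_rw 3 [← h]
    rw [zpow_ofNat]
    ring
  rw [zpow_neg]
  exact eq_inv_of_mul_eq_one_left h1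

lemma slash_T (hf : IsAutomorphic k f) (z : ℍ) : slash k T f z = xi k * f z := by
  rw [hf, mult_T]

lemma slash_S (hf : IsAutomorphic k f) (z : ℍ) : slash k S f z = xi k ^ (-3 : ℤ) * f z := by
  by_cases h0 : f = 0
  · simp [h0, slash]
  · rw [hf, hf.mult_S h0]

lemma vadd_one (hf : IsAutomorphic k f) (z : ℍ) : f ((1 : ℝ) +ᵥ z) = xi k * f z := by
  have hd : denom T z = 1 := by rw [denom_apply]; simp [T]
  have : argFactor k 1 = 1 := by simpa using argFactor_of_pos k one_pos
  rw [← hf.slash_T, slash_eq_slashGL, slashGL, hd, this, one_mul, ← modular_T_smul]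
  rfl

lemma vadd_int (hf : IsAutomorphic k f) (n : ℤ) (z : ℍ) :
    f ((n : ℝ) +ᵥ z) = xi k ^ n * f z := by
  induction n with
  | zero => simp
  | succ n ih =>
    have : ((((n : ℤ) + 1 : ℤ) : ℝ)) +ᵥ z = (1 : ℝ) +ᵥ ((((n : ℤ) : ℝ)) +ᵥ z) := by
      rw [vadd_vadd]; push_cast; rw [add_comm]
    rw [this, hf.vadd_one, ih, zpow_add_one₀ (xi_ne_zero k)]
    ring
  | pred n ih =>
    have : (((-(n : ℤ) : ℤ) : ℝ)) +ᵥ z = (1 : ℝ) +ᵥ ((((-(n : ℤ) - 1 : ℤ) : ℝ)) +ᵥ z) := by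
      rw [vadd_vadd]; push_cast; ring_nf
    rw [this, hf.vadd_one] at ih
    refine mul_left_cancel₀ (xi_ne_zero k) ?_
    rw [ih, ← mul_assoc, zpow_sub_one₀ (xi_ne_zero k)]
    have := xi_ne_zero k
    field_simp

lemma norm_vadd_int (hf : IsAutomorphic k f) (n : ℤ) (z : ℍ) :
    ‖f ((n : ℝ) +ᵥ z)‖ = ‖f z‖ := by
  have : ‖xi k‖ = 1 := by
    rw [xi, show 2 * Real.pi * Complex.I * (k / 12) = ((2 * Real.pi * (k / 12) : ℝ) : ℂ) * Complex.I
      by push_cast; ring, Complex.norm_exp_ofReal_mul_I]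
  rw [hf.vadd_int, norm_mul, norm_zpow, this, one_zpow, one_mul]

lemma heckeOp (hf : IsAutomorphic k f) {m : ℕ} (hm : 1 ≤ m) (hkm : (12 : ℤ) ∣ k * m - k) :
    IsAutomorphic k (heckeOp k m f) := by
  -- The character property of `v` is drawn from a nonzero `f`; for `f = 0` both sides vanish.
  by_cases h0 : f = 0
  · have : MaassHecke.heckeOp k m f = 0 := by
      funext z
      simp [h0, MaassHecke.heckeOp, heckeTerm]
    intro A z
    simp [this, slash]
  have hm' : 0 < (m : ℤ) := by exact_mod_cast hm
  have hop : MaassHecke.heckeOp k m f = fun z ↦ 1 / (Real.sqrt m : ℂ) *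
      ∑ M : reps (m : ℤ), twist k f hm' M.1 z := funext fun z ↦ heckeOp_eq_sum_twist k f hm' z
  have gen (A : SL(2, ℤ)) (e : ℤ) (hA : mult k A = xi k ^ e)
      (he : ∀ M : FixedDetMatrix (Fin 2) ℤ m,
        (12 : ℤ) ∣ k * (matPsi (mulRight M A) - matPsi M - e)) (z : ℍ) :
      slash k A (MaassHecke.heckeOp k m f) z = mult k A * MaassHecke.heckeOp k m f z := by
    rw [hop, slash_mul_const, slash_sum_twist k hf.slash_T hf.slash_S hm' hkm A e he, hA]
    ring
  intro A
  have hmem : A ∈ Subgroup.closure {S, T} := by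
    rw [SpecialLinearGroup.SL2Z_generators]; trivial
  induction hmem using Subgroup.closure_induction with
  | mem B hB =>
    rcases hB with rfl | rfl
    · exact gen S (-3) (hf.mult_S h0) fun M ↦ by simpa using (matPsi_dvd hkm M).2.2.2
    · exact gen T 1 (by rw [mult_T, zpow_one]) fun M ↦ (matPsi_dvd hkm M).2.2.1
  | one => intro z; rw [slash_one, hf.mult_one h0, one_mul]
  | mul A B _ _ hA hB =>
    intro z
    rw [slash_mul, funext hA, slash_mul_const, hB, hf.mult_mul h0, mul_assoc]
  | inv A _ hA =>
    intro z
    have h1 : slash k A⁻¹ (slash k A (MaassHecke.heckeOp k m f)) z = MaassHecke.heckeOp k m f z := by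
      rw [← slash_mul, mul_inv_cancel, slash_one]
    rw [funext hA, slash_mul_const] at h1
    refine mul_left_cancel₀ (hf.mult_ne_zero h0 A) ?_
    rw [h1, ← mul_assoc, ← hf.mult_mul h0, mul_inv_cancel, hf.mult_one h0, one_mul]

end IsAutomorphic

end MaassHecke
end

/-! ### Smoothness, eigenvalue equation and square integrability -/

noncomputable section

namespace MaassHecke

lemma isOpen_im_pos : IsOpen {z : ℂ | 0 < z.im} := isOpen_lt continuous_const Complex.continuous_im

/-- Smooth solutions of the eigenvalue equation that are square integrable over `𝒟`. -/
def waveSpace (k : ℕ) (R : ℝ) : Submodule ℂ (ℍ → ℂ) where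
  carrier := {f | ContDiffOn ℝ ∞ (f ∘ ofComplex) {z : ℂ | 0 < z.im} ∧
    (∀ z : ℍ, laplace k f z + ((1 / 4 + R ^ 2 : ℝ) : ℂ) * f z = 0) ∧
    MemLp f 2 (volume.restrict 𝒟)}
  zero_mem' := by
    obtain ⟨h1, -, h3, h4⟩ := (maassSpace k R).zero_mem
    exact ⟨h1, h3, h4⟩
  add_mem' := by
    rintro f g ⟨hf1, hf3, hf4⟩ ⟨hg1, hg3, hg4⟩
    have hc : ((f + g) ∘ ofComplex) = f ∘ ofComplex + g ∘ ofComplex := rfl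
    refine ⟨by rw [hc]; exact hf1.add hg1, fun z ↦ ?_, hf4.add hg4⟩
    have hz : {z : ℂ | 0 < z.im} ∈ nhds (z : ℂ) := isOpen_im_pos.mem_nhds z.im_pos
    have cf := hf1.contDiffAt hz
    have cg := hg1.contDiffAt hz
    have h1 := hf3 z
    have h2 := hg3 z
    simp only [laplace, hc] at *
    rw [ContDiffAt.laplacian_add (cf.of_le (ENat.LEInfty.out)) (cg.of_le (ENat.LEInfty.out)),
      fderiv_add (cf.differentiableAt (by simp)) (cg.differentiableAt (by simp))]
    simp only [Pi.add_apply, add_apply]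
    linear_combination h1 + h2
  smul_mem' := by
    rintro a f ⟨hf1, hf3, hf4⟩
    have hc : ((a • f) ∘ ofComplex) = a • (f ∘ ofComplex) := rfl
    refine ⟨by rw [hc]; exact contDiffOn_const.smul hf1, fun z ↦ ?_, hf4.const_smul a⟩
    have hz : {z : ℂ | 0 < z.im} ∈ nhds (z : ℂ) := isOpen_im_pos.mem_nhds z.im_pos
    have cf := hf1.contDiffAt hz
    have h1 := hf3 z
    simp only [laplace, hc] at *
    rw [InnerProductSpace.laplacian_smul a (cf.of_le (ENat.LEInfty.out)),
      fderiv_const_smul (cf.differentiableAt (by simp))]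
    simp only [Pi.smul_apply, smul_apply, smul_eq_mul]
    linear_combination a * h1

lemma mem_maassSpace_iff {k : ℕ} {R : ℝ} {f : ℍ → ℂ} :
    f ∈ maassSpace k R ↔ f ∈ waveSpace k R ∧ IsAutomorphic k f :=
  ⟨fun ⟨h1, h2, h3, h4⟩ ↦ ⟨⟨h1, h3, h4⟩, h2⟩, fun ⟨⟨h1, h3, h4⟩, h2⟩ ↦ ⟨h1, h2, h3, h4⟩⟩

section Affine

variable {r : ℝ} (t : ℝ) (F : ℂ → ℂ)

lemma iteratedFDeriv_two_comp_affine (hr : r ≠ 0) (z v : ℂ) :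
    iteratedFDeriv ℝ 2 (fun w ↦ F (r * w + t)) z ![v, v]
      = (r : ℂ) ^ 2 * iteratedFDeriv ℝ 2 F (r * z + t) ![v, v] := by
  let e : ℂ ≃L[ℝ] ℂ := ContinuousLinearEquiv.smulLeft (Units.mk0 r hr)
  have he : ∀ w, e w = r • w := fun w ↦ rfl
  have h1 : (fun w ↦ F (r * w + t)) = (fun w ↦ F (w + t)) ∘ e := by
    funext w
    simp [he]
  have h2 := e.iteratedFDerivWithin_comp_right (fun w ↦ F (w + t)) uniqueDiffOn_univ
    (Set.mem_univ (e z)) 2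
  rw [Set.preimage_univ, iteratedFDerivWithin_univ, iteratedFDerivWithin_univ,
    iteratedFDeriv_comp_add_right] at h2
  rw [h1, h2, ContinuousMultilinearMap.compContinuousLinearMap_apply]
  have h3 : (fun i ↦ (e : ℂ →L[ℝ] ℂ) (![v, v] i)) = fun i ↦ r • (![v, v] : Fin 2 → ℂ) i := rfl
  rw [h3, ContinuousMultilinearMap.map_smul_univ]
  simp [he]

lemma laplacian_comp_affine (hr : r ≠ 0) (z : ℂ) :
    Laplacian.laplacian (fun w ↦ F (r * w + t)) z
      = (r : ℂ) ^ 2 * Laplacian.laplacian F (r * z + t) := by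
  simp only [InnerProductSpace.laplacian_eq_iteratedFDeriv_complexPlane,
    iteratedFDeriv_two_comp_affine t F hr, mul_add]

lemma fderiv_comp_affine {F : ℂ → ℂ} {z : ℂ} (hF : DifferentiableAt ℝ F (r * z + t)) :
    fderiv ℝ (fun w ↦ F (r * w + t)) z 1 = r * fderiv ℝ F (r * z + t) 1 := by
  have h1 : HasFDerivAt (fun w : ℂ ↦ (r : ℂ) * w + t) ((r : ℂ) • ContinuousLinearMap.id ℝ ℂ) z := by
    exact ((hasFDerivAt_id z).const_mul (r : ℂ)).add_const (t : ℂ)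
  have h2 := (hF.hasFDerivAt.comp z h1).fderiv
  change fderiv ℝ (F ∘ fun w ↦ (r : ℂ) * w + t) z 1 = _
  rw [h2]
  have : (r : ℂ) = r • (1 : ℂ) := by simp
  simp only [ContinuousLinearMap.comp_apply, smul_apply,
    ContinuousLinearMap.id_apply, smul_eq_mul, mul_one]
  conv_lhs => rw [this]
  rw [map_smul]
  simp

end Affine

section AffinePt

variable {a d : ℕ} (ha : 0 < a) (hd : 0 < d) (b : ℤ)
include ha hd

lemma coe_affinePt' (z : ℍ) :
    (affinePt a d b z : ℂ) = ((a / d : ℝ) : ℂ) * z + ((b / d : ℝ) : ℂ) := by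
  rw [coe_affinePt ha hd]
  push_cast
  ring

lemma im_affinePt (z : ℍ) : (affinePt a d b z).im = a / d * z.im := by
  rw [← coe_im, coe_affinePt' ha hd]
  simp [-Complex.ofReal_div]

lemma re_affinePt (z : ℍ) : (affinePt a d b z).re = a / d * z.re + b / d := by
  rw [← coe_re, coe_affinePt' ha hd]
  simp [-Complex.ofReal_div]

lemma comp_affinePt_eventuallyEq (f : ℍ → ℂ) (z : ℂ) (hz : 0 < z.im) :
    (f ∘ affinePt a d b) ∘ ofComplex
      =ᶠ[nhds z] fun w ↦ (f ∘ ofComplex) (((a / d : ℝ) : ℂ) * w + ((b / d : ℝ) : ℂ)) := by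
  filter_upwards [isOpen_im_pos.mem_nhds hz] with w hw
  simp only [Function.comp_apply]
  rw [← coe_affinePt' ha hd b ⟨w, hw⟩, ofComplex_apply, ofComplex_apply_of_im_pos hw]

lemma exists_affinePt_eq_smul : ∃ g : GL (Fin 2) ℝ, affinePt a d b = fun z ↦ g • z := by
  have hdet : 0 < (!![(a : ℝ), b; 0, d]).det := by
    rw [Matrix.det_fin_two_of, mul_zero, sub_zero]
    positivity
  obtain ⟨g, hg⟩ : ∃ g : GL (Fin 2) ℝ, g.val = !![(a : ℝ), b; 0, d] :=
    ⟨Matrix.GeneralLinearGroup.mkOfDetNeZero _ hdet.ne', rfl⟩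
  have hg' : 0 < g.det.val := by
    rw [← hg] at hdet
    exact hdet
  refine ⟨g, funext fun z ↦ ?_⟩
  ext
  rw [coe_affinePt ha hd, coe_smul_of_det_pos hg', num, denom, hg]
  simp

lemma continuous_affinePt : Continuous (affinePt a d b) := by
  rw [isEmbedding_coe.continuous_iff]
  have : (UpperHalfPlane.coe ∘ affinePt a d b) = fun z : ℍ ↦ (a * (z : ℂ) + b) / d :=
    funext fun z ↦ coe_affinePt ha hd b z
  rw [this]
  have := continuous_coe
  fun_prop

end AffinePt

lemma contDiffOn_comp_affinePt {a d : ℕ} (ha : 0 < a) (hd : 0 < d) (b : ℤ) {f : ℍ → ℂ}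
    (hf : ContDiffOn ℝ ∞ (f ∘ ofComplex) {z : ℂ | 0 < z.im}) :
    ContDiffOn ℝ ∞ ((f ∘ affinePt a d b) ∘ ofComplex) {z : ℂ | 0 < z.im} := by
  intro z hz
  have h1 := comp_affinePt_eventuallyEq ha hd b f z hz
  refine ContDiffAt.contDiffWithinAt (ContDiffAt.congr_of_eventuallyEq ?_ h1)
  have h2 : 0 < (((a / d : ℝ) : ℂ) * z + ((b / d : ℝ) : ℂ)).im := by
    rw [← coe_affinePt' ha hd b ⟨z, hz⟩]
    exact im_pos _
  exact ContDiffAt.comp (g := f ∘ ofComplex)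
    (f := fun w ↦ ((a / d : ℝ) : ℂ) * w + ((b / d : ℝ) : ℂ)) z
    (hf.contDiffAt (isOpen_im_pos.mem_nhds h2)) (by fun_prop)

/-- Each derivative gains a factor `a/d`, which the factors `y²` and `y` of `Δ_k` absorb because the
height is scaled by `a/d` too. -/
lemma laplace_comp_affinePt {a d : ℕ} (ha : 0 < a) (hd : 0 < d) (b : ℤ) (k : ℕ) {f : ℍ → ℂ}
    (hf : ContDiffOn ℝ ∞ (f ∘ ofComplex) {z : ℂ | 0 < z.im}) (z : ℍ) :
    laplace k (f ∘ affinePt a d b) z = laplace k f (affinePt a d b z) := by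
  have h1 := comp_affinePt_eventuallyEq ha hd b f z z.im_pos
  have hr : (a / d : ℝ) ≠ 0 := by positivity
  have hdf : DifferentiableAt ℝ (f ∘ ofComplex)
      (((a / d : ℝ) : ℂ) * z + ((b / d : ℝ) : ℂ)) := by
    rw [← coe_affinePt' ha hd b z]
    exact (hf.contDiffAt (isOpen_im_pos.mem_nhds (im_pos _))).differentiableAt (by simp)
  rw [laplace, laplace, (InnerProductSpace.laplacian_congr_nhds h1).eq_of_nhds, h1.fderiv_eq,
    laplacian_comp_affine _ _ hr, fderiv_comp_affine _ hdf, ← coe_affinePt' ha hd b z,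
    im_affinePt ha hd]
  push_cast
  ring

lemma continuous_of_contDiffOn {f : ℍ → ℂ}
    (hf : ContDiffOn ℝ ∞ (f ∘ ofComplex) {z : ℂ | 0 < z.im}) : Continuous f := by
  have h : f = (f ∘ ofComplex) ∘ UpperHalfPlane.coe := by
    funext z
    simp [ofComplex_apply]
  rw [h]
  exact hf.continuousOn.comp_continuous continuous_coe fun z ↦ z.im_pos

lemma integrableOn_smul_preimage {φ : ℍ → ℝ} (g : GL (Fin 2) ℝ) {s : Set ℍ}
    (h : IntegrableOn φ s) : IntegrableOn (fun z ↦ φ (g • z)) ((fun z ↦ g • z) ⁻¹' s) :=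
  ((measurePreserving_smul g (volume : Measure ℍ)).integrableOn_comp_preimage
    (measurableEmbedding_const_smul g)).2 h

lemma integrableOn_strip {φ : ℍ → ℝ} (hφ : ∀ (n : ℤ) (z : ℍ), φ ((n : ℝ) +ᵥ z) = φ z)
    (h : IntegrableOn φ 𝒟) (N : ℕ) : IntegrableOn φ {z : ℍ | 1 ≤ z.im ∧ |z.re| ≤ N} := by
  have h1 (n : ℤ) : IntegrableOn φ {z : ℍ | ((n : ℝ) +ᵥ z) ∈ 𝒟} := by
    have h2 := integrableOn_smul_preimage ((ModularGroup.T ^ n : SL(2, ℤ)) : GL (Fin 2) ℝ) h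
    have e (z : ℍ) : ((ModularGroup.T ^ n : SL(2, ℤ)) : GL (Fin 2) ℝ) • z = (n : ℝ) +ᵥ z :=
      modular_T_zpow_smul z n
    simp only [e, hφ] at h2
    exact h2
  have h2 := integrableOn_finset_iUnion (s := Finset.Icc (-(N + 1 : ℤ)) (N + 1))
    (t := fun n : ℤ ↦ {z : ℍ | ((n : ℝ) +ᵥ z) ∈ 𝒟}) |>.2 fun n _ ↦ h1 n
  refine h2.mono_set ?_
  rintro z ⟨hz1, hz2⟩
  have hr := abs_sub_round z.re
  simp only [Set.mem_iUnion]
  -- Translating by `-round z.re` brings the real part into `[-1/2, 1/2]`, and height at least `1`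
  -- then puts the point in `𝒟`.
  refine ⟨-round z.re, ?_, ?_, ?_⟩
  · rw [abs_le] at hr hz2
    have h3 : (round z.re : ℝ) < N + 1 := by linarith
    have h4 : (-(N + 1) : ℝ) < round z.re := by linarith
    have h3' : round z.re < N + 1 := by exact_mod_cast h3
    have h4' : -(N + 1 : ℤ) < round z.re := by exact_mod_cast h4
    rw [Finset.mem_Icc]
    omega
  · rw [Complex.normSq_apply, coe_re, coe_im, vadd_im]
    nlinarith [mul_self_nonneg (((-round z.re : ℤ) : ℝ) +ᵥ z).re]
  · rw [vadd_re]
    push_cast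
    rwa [neg_add_eq_sub]

/-- Cut `𝒟` at height `d/a`. The lower part is compact and the function continuous. The upper part
is mapped to height at least `1` and bounded real part, and the map preserves the hyperbolic
measure, so `integrableOn_strip` applies. -/
lemma memLp_comp_affinePt {a d : ℕ} (ha : 0 < a) (hd : 0 < d) (b : ℤ) {f : ℍ → ℂ}
    (hf : Continuous f) (hinv : ∀ (n : ℤ) (z : ℍ), ‖f ((n : ℝ) +ᵥ z)‖ = ‖f z‖)
    (hL : MemLp f 2 (volume.restrict 𝒟)) :
    MemLp (f ∘ affinePt a d b) 2 (volume.restrict 𝒟) := by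
  have hc := hf.comp (continuous_affinePt ha hd b)
  rw [memLp_two_iff_integrable_sq_norm hf.aestronglyMeasurable] at hL
  rw [memLp_two_iff_integrable_sq_norm hc.aestronglyMeasurable]
  have h1 : IntegrableOn (fun z ↦ ‖(f ∘ affinePt a d b) z‖ ^ 2)
      (ModularGroup.truncatedFundamentalDomain (d / a)) :=
    (hc.norm.pow 2).continuousOn.integrableOn_compact
      (ModularGroup.isCompact_truncatedFundamentalDomain _)
  have h2 := integrableOn_strip (φ := fun z ↦ ‖f z‖ ^ 2) (fun n z ↦ by rw [hinv]) hL
    (a + b.natAbs)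
  obtain ⟨g, hg⟩ := exists_affinePt_eq_smul ha hd b
  have h3 : IntegrableOn (fun z ↦ ‖(f ∘ affinePt a d b) z‖ ^ 2)
      (affinePt a d b ⁻¹' {z : ℍ | 1 ≤ z.im ∧ |z.re| ≤ (a + b.natAbs : ℕ)}) := by
    rw [hg]
    exact integrableOn_smul_preimage g h2
  refine (h1.union h3).mono_set fun z hz ↦ ?_
  by_cases hy : z.im ≤ d / a
  · exact Or.inl ⟨hz, hy⟩
  right
  push Not at hy
  have ha' : (0 : ℝ) < a := by exact_mod_cast ha
  have hd' : (1 : ℝ) ≤ d := by exact_mod_cast hd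
  refine ⟨?_, ?_⟩
  · rw [im_affinePt ha hd, div_mul_eq_mul_div, le_div_iff₀ (by positivity)]
    rw [div_lt_iff₀ ha'] at hy
    linarith
  · rw [re_affinePt ha hd, div_mul_eq_mul_div, ← add_div, abs_div,
      abs_of_pos (by positivity : (0 : ℝ) < d), div_le_iff₀ (by positivity)]
    have hx := hz.2
    calc |a * z.re + b| ≤ |a * z.re| + |(b : ℝ)| := abs_add_le _ _
      _ ≤ a + |(b : ℝ)| := by
        rw [abs_mul, abs_of_pos ha']
        nlinarith
      _ ≤ (a + |(b : ℝ)|) * d := le_mul_of_one_le_right (by positivity) hd'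
      _ = _ := by push_cast [Nat.cast_natAbs]; rfl

lemma heckeOp_mem {k m : ℕ} {R : ℝ} (hm : 1 ≤ m) (hkm : (12 : ℤ) ∣ k * m - k) {f : ℍ → ℂ}
    (hf : f ∈ maassSpace k R) : heckeOp k m f ∈ maassSpace k R := by
  rw [mem_maassSpace_iff] at hf ⊢
  obtain ⟨⟨h1, h3, h4⟩, h2⟩ := hf
  refine ⟨?_, h2.heckeOp hm hkm⟩
  have hop : heckeOp k m f = (1 / (Real.sqrt m : ℂ)) • ∑ p ∈ m.divisorsAntidiagonal,
      chi k p.2 • ∑ b ∈ Finset.range p.2, xi k ^ (-((b : ℤ) * p.2)) • (f ∘ affinePt p.1 p.2 b) := by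
    funext z
    simp only [heckeOp, heckeTerm, Pi.smul_apply, Finset.sum_apply, smul_eq_mul]
    rfl
  rw [hop]
  refine Submodule.smul_mem _ _ (Submodule.sum_mem _ fun p hp ↦ Submodule.smul_mem _ _
    (Submodule.sum_mem _ fun b _ ↦ Submodule.smul_mem _ _ ?_))
  obtain ⟨hp1, hp0⟩ := Nat.mem_divisorsAntidiagonal.1 hp
  have ha : 0 < p.1 := Nat.pos_of_ne_zero (by rintro h; simp [h] at hp1; omega)
  have hd : 0 < p.2 := Nat.pos_of_ne_zero (by rintro h; simp [h] at hp1; omega)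
  refine ⟨contDiffOn_comp_affinePt ha hd b h1, fun z ↦ ?_,
    memLp_comp_affinePt ha hd b (continuous_of_contDiffOn h1) h2.norm_vadd_int h4⟩
  rw [laplace_comp_affinePt ha hd b k h1]
  exact h3 _

end MaassHecke
end

/-! ### Fourier coefficients of `T_m f` -/

noncomputable section

namespace MaassHecke

-- The hypothesis makes `d` a unit modulo `12/gcd(12,k)`, and every unit modulo a divisor of `12`
-- has square `1`.
set_option maxRecDepth 100000 in
lemma mul_sq_zmod : ∀ k a d : ZMod 12, k * (a * d) = k → k * d ^ 2 = k := by
  decide +kernel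

lemma twelve_dvd_mul_sq_sub_one {k a d : ℤ} (h : 12 ∣ k * (a * d) - k) :
    12 ∣ k * (d ^ 2 - 1) := by
  have h1 := (ZMod.intCast_zmod_eq_zero_iff_dvd _ 12).2 h
  refine (ZMod.intCast_zmod_eq_zero_iff_dvd _ 12).1 ?_
  push_cast at h1 ⊢
  rw [sub_eq_zero] at h1
  rw [mul_sub, mul_sq_zmod k a d h1]
  ring

lemma twelve_dvd_mul_sub {k a d : ℤ} (h : 12 ∣ k * (a * d) - k) : 12 ∣ k * (d - a) := by
  have h2 := twelve_dvd_mul_sq_sub_one h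
  have : k * (d - a) = a * (k * (d ^ 2 - 1)) - d * (k * (a * d) - k) := by ring
  rw [this]
  exact dvd_sub (h2.mul_left a) (h.mul_left d)

lemma chi_congr {k a d : ℕ} (h : (12 : ℤ) ∣ k * (a * d) - k) : chi k d = chi k a := by
  rw [chi_eq_xi_zpow, chi_eq_xi_zpow]
  refine xi_zpow_congr ?_
  obtain ⟨q, hq⟩ := twelve_dvd_mul_sub h
  exact ⟨3 * q, by linear_combination 3 * hq⟩

/-- Replacing `b` by `b + dt` translates the point by `t`, which contributes `ξ^t`. The prefactor
changes by `ξ ^ (-d²t)`, and the two cancel because `12 ∣ k(d² - 1)`. -/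
lemma heckeTerm_congr {k a d : ℕ} {f : ℍ → ℂ} (hf : IsAutomorphic k f) (ha : 0 < a) (hd : 0 < d)
    (h : (12 : ℤ) ∣ k * (a * d) - k) {b b' : ℤ} (hb : b ≡ b' [ZMOD d]) (z : ℍ) :
    heckeTerm k f a d b z = heckeTerm k f a d b' z := by
  obtain ⟨t, ht⟩ := hb.dvd
  have hb' : b' = b + d * t := by linarith
  have h1 : affinePt a d b' z = (t : ℝ) +ᵥ affinePt a d b z := by
    ext
    rw [coe_vadd, coe_affinePt ha hd, coe_affinePt ha hd, hb']
    have : (d : ℂ) ≠ 0 := by exact_mod_cast hd.ne'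
    push_cast
    field_simp
    ring
  change _ * f (affinePt a d b z) = _ * f (affinePt a d b' z)
  rw [h1, hf.vadd_int, ← mul_assoc, ← zpow_add₀ (xi_ne_zero k)]
  congr 1
  refine xi_zpow_congr ?_
  obtain ⟨q, hq⟩ := twelve_dvd_mul_sq_sub_one h
  rw [hb']
  exact ⟨t * q, by linear_combination t * hq⟩

/-- The function `𝒲` with an arbitrary real frequency `s`. -/
def waveW (k : ℕ) (R s : ℝ) (z : ℍ) : ℂ :=
  1 / (Real.sqrt |s| : ℂ) *
    whittakerW (((k : ℝ) / 2 * Real.sign s : ℝ) : ℂ) (Complex.I * R) (4 * Real.pi * |s| * z.im) *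
    Complex.exp (2 * Real.pi * Complex.I * s * z.re)

lemma fourierW_eq_waveW (n : ℤ) (k : ℕ) (R : ℝ) (z : ℍ) :
    fourierW n k R z = waveW k R (n + k / 12) z := rfl

lemma sign_mul_of_pos {r : ℝ} (hr : 0 < r) (s : ℝ) : Real.sign (s * r) = Real.sign s := by
  rcases lt_trichotomy s 0 with h | rfl | h
  · rw [Real.sign_of_neg h, Real.sign_of_neg (mul_neg_of_neg_of_pos h hr)]
  · simp
  · rw [Real.sign_of_pos h, Real.sign_of_pos (mul_pos h hr)]

lemma waveW_affinePt (k : ℕ) (R s : ℝ) {a d : ℕ} (ha : 0 < a) (hd : 0 < d) (b : ℤ) (z : ℍ) :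
    waveW k R s (affinePt a d b z) = (Real.sqrt (a / d) : ℂ) *
      Complex.exp (2 * Real.pi * Complex.I * s * (b / d)) * waveW k R (s * (a / d)) z := by
  have hr : (0 : ℝ) < a / d := by positivity
  have h1 : (Real.sqrt |s * (a / d)| : ℂ) = (Real.sqrt |s| : ℂ) * (Real.sqrt (a / d) : ℂ) := by
    rw [abs_mul, abs_of_pos hr, Real.sqrt_mul (abs_nonneg s)]
    push_cast
    rfl
  have h2 : (Real.sqrt (a / d) : ℂ) ≠ 0 := by
    exact_mod_cast (Real.sqrt_pos.2 hr).ne'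
  have h3 : Complex.exp (2 * Real.pi * Complex.I * s * ((a / d * z.re + b / d : ℝ) : ℂ)) =
      Complex.exp (2 * Real.pi * Complex.I * s * (b / d)) *
        Complex.exp (2 * Real.pi * Complex.I * ((s * (a / d) : ℝ) : ℂ) * z.re) := by
    rw [← Complex.exp_add]
    congr 1
    push_cast
    ring
  have h4 : 4 * Real.pi * |s| * (a / d * z.im) = 4 * Real.pi * |s * (a / d)| * z.im := by
    rw [abs_mul, abs_of_pos hr]
    ring
  have h5 : (1 : ℂ) / (Real.sqrt |s| : ℂ)
      = (Real.sqrt (a / d) : ℂ) * (1 / ((Real.sqrt |s| : ℂ) * (Real.sqrt (a / d) : ℂ))) := by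
    rw [one_div, one_div, mul_inv, mul_left_comm, mul_inv_cancel₀ h2, mul_one]
  rw [waveW, waveW, re_affinePt ha hd, im_affinePt ha hd, h1, h3, h4, sign_mul_of_pos hr, h5]
  ring

lemma sum_range_exp {d : ℕ} (hd : 0 < d) (u : ℤ) :
    ∑ b ∈ Finset.range d, Complex.exp (2 * Real.pi * Complex.I * (u / d)) ^ b
      = if (d : ℤ) ∣ u then (d : ℂ) else 0 := by
  have hd0 : (d : ℂ) ≠ 0 := by exact_mod_cast hd.ne'
  split_ifs with h
  · obtain ⟨l, rfl⟩ := h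
    have : Complex.exp (2 * Real.pi * Complex.I * (((d * l : ℤ) : ℂ) / d)) = 1 := by
      rw [Complex.exp_eq_one_iff]
      exact ⟨l, by push_cast; field_simp⟩
    simp only [this, one_pow, Finset.sum_const, Finset.card_range, nsmul_eq_mul, mul_one]
  · have h1 : Complex.exp (2 * Real.pi * Complex.I * (u / d)) ≠ 1 := by
      rw [Ne, Complex.exp_eq_one_iff]
      rintro ⟨l, hl⟩
      refine h ⟨l, ?_⟩
      have h2 : (u : ℂ) / d = l := by
        refine mul_left_cancel₀ Complex.two_pi_I_ne_zero ?_
        rw [hl]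
        ring
      rw [div_eq_iff hd0] at h2
      have h3 : (u : ℂ) = ((d * l : ℤ) : ℂ) := by push_cast; rw [h2]; ring
      exact_mod_cast h3
    have h2 : Complex.exp (2 * Real.pi * Complex.I * (u / d)) ^ d = 1 := by
      rw [← Complex.exp_nat_mul, Complex.exp_eq_one_iff]
      exact ⟨u, by field_simp⟩
    rw [geom_sum_eq h1, h2, sub_self, zero_div]

/-- The phases combine to `(b/d)(n - k(d²-1)/12)`, so this is a geometric sum over a `d`-th root of
unity. -/
lemma sum_xi_mul_exp {k a d : ℕ} (hd : 0 < d) (h : (12 : ℤ) ∣ k * (a * d) - k) (n : ℤ) :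
    ∑ b ∈ Finset.range d, xi k ^ (-((b : ℤ) * d)) *
        Complex.exp (2 * Real.pi * Complex.I * ((n + k / 12 : ℝ) : ℂ) * ((b : ℤ) / d))
      = if (d : ℤ) ∣ n - (k : ℤ) * ((d : ℤ) ^ 2 - 1) / 12 then (d : ℂ) else 0 := by
  rw [← sum_range_exp hd]
  have hd0 : (d : ℂ) ≠ 0 := by exact_mod_cast hd.ne'
  obtain ⟨e, he⟩ := twelve_dvd_mul_sq_sub_one h
  refine Finset.sum_congr rfl fun b _ ↦ ?_
  rw [he, Int.mul_ediv_cancel_left _ (by norm_num), xi_zpow, ← Complex.exp_add,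
    ← Complex.exp_nat_mul]
  have he' : (k : ℂ) * (d ^ 2 - 1) = 12 * e := by exact_mod_cast he
  congr 1
  push_cast
  field_simp
  linear_combination (-b : ℂ) * he'

lemma hasSum_sum_heckeTerm {k : ℕ} {R : ℝ} {f : ℍ → ℂ} {c : ℤ → ℂ} (hf : HasFourierCoeffs k R f c)
    {a d : ℕ} (ha : 0 < a) (hd : 0 < d) (h : (12 : ℤ) ∣ k * (a * d) - k) (z : ℍ) :
    HasSum (fun n : ℤ ↦ if (a : ℤ) ∣ n - (k : ℤ) * ((a * d : ℤ) - 1) / 12 then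
        (Real.sqrt (a * d) : ℂ) * c ((k : ℤ) * ((d : ℤ) ^ 2 - 1) / 12 +
          d * ((n - (k : ℤ) * ((a * d : ℤ) - 1) / 12) / a)) * fourierW n k R z else 0)
      (∑ b ∈ Finset.range d, heckeTerm k f a d b z) := by
  have hd0 : (d : ℤ) ≠ 0 := by exact_mod_cast hd.ne'
  have ha0 : (a : ℤ) ≠ 0 := by exact_mod_cast ha.ne'
  have hdR : (0 : ℝ) < d := by exact_mod_cast hd
  obtain ⟨e, he⟩ := twelve_dvd_mul_sq_sub_one h
  obtain ⟨E, hE⟩ : (12 : ℤ) ∣ k * ((a * d : ℤ) - 1) := by rwa [mul_sub, mul_one]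
  have hsq : Real.sqrt (a * d) = Real.sqrt (a / d) * d := by
    rw [show (a * d : ℝ) = a / d * d ^ 2 by field_simp, Real.sqrt_mul (by positivity),
      Real.sqrt_sq hdR.le]
  have h1 : HasSum (fun n : ℤ ↦ if (d : ℤ) ∣ n - e then
      c n * ((Real.sqrt (a * d) : ℂ) * waveW k R ((n + k / 12) * (a / d)) z) else 0)
      (∑ b ∈ Finset.range d, heckeTerm k f a d b z) := by
    refine (hasSum_sum (s := Finset.range d) fun b _ ↦
      (hf (affinePt a d b z)).mul_left (xi k ^ (-((b : ℤ) * d)))).congr_fun fun n ↦ ?_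
    have h2 := sum_xi_mul_exp hd h n
    rw [he, Int.mul_ediv_cancel_left _ (by norm_num)] at h2
    simp only [fourierW_eq_waveW, waveW_affinePt k R _ ha hd]
    calc _ = c n * (Real.sqrt (a / d) : ℂ) * waveW k R ((n + k / 12) * (a / d)) z *
          (if (d : ℤ) ∣ n - e then (d : ℂ) else 0) := by
          rw [hsq]
          push_cast
          split_ifs <;> ring
      _ = _ := by
          rw [← h2, Finset.mul_sum]
          exact Finset.sum_congr rfl fun b _ ↦ by ring
  rw [he, hE, Int.mul_ediv_cancel_left _ (by norm_num), Int.mul_ediv_cancel_left _ (by norm_num)]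
  have hinj : Function.Injective fun l : ℤ ↦ e + d * l := fun l l' hl ↦
    mul_left_cancel₀ hd0 (add_left_cancel hl)
  have hinj' : Function.Injective fun l : ℤ ↦ E + a * l := fun l l' hl ↦
    mul_left_cancel₀ ha0 (add_left_cancel hl)
  -- Only `n = e + dl` survives in the old series, and only `n = E + al` in the new one. Both are
  -- indexed by the same `l`.
  rw [← hinj.hasSum_iff] at h1
  · rw [← hinj'.hasSum_iff]
    · refine h1.congr_fun fun l ↦ ?_
      simp only [Function.comp_apply, add_sub_cancel_left, dvd_mul_right, if_true,
        Int.mul_ediv_cancel_left _ ha0]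
      have heR : (k : ℝ) * (d ^ 2 - 1) = 12 * e := by exact_mod_cast he
      have hER : (k : ℝ) * (a * d - 1) = 12 * E := by exact_mod_cast hE
      -- The rescaled frequency is again in `ℤ + k/12`, by `k(d²-1) = 12e` and `k(ad-1) = 12E`.
      have hs : (((e + d * l : ℤ) : ℝ) + k / 12) * (a / d) = ((E + a * l : ℤ) : ℝ) + k / 12 := by
        push_cast
        field_simp
        linear_combination (-a : ℝ) * heR + d * hER
      rw [hs, fourierW_eq_waveW]
      ring
    · intro n hn
      refine if_neg fun ⟨l, hl⟩ ↦ hn ⟨l, ?_⟩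
      change E + a * l = n
      linarith
  · intro n hn
    refine if_neg fun ⟨l, hl⟩ ↦ hn ⟨l, ?_⟩
    change e + d * l = n
    linarith

lemma coeffAt_intCast (c : ℤ → ℂ) (n : ℤ) : coeffAt c n = c n := by
  simp [coeffAt]

/-- The divisor called `d` in `heckeCoeff` is the cofactor `a` here; `chi_congr` allows the
exchange, as `χ_k(d) = χ_k(a)`. -/
lemma heckeCoeff_eq_sum {k m : ℕ} (hm : 1 ≤ m) (hkm : (12 : ℤ) ∣ k * m - k) (c : ℤ → ℂ) (n : ℤ) :
    heckeCoeff k m c n = ∑ p ∈ m.divisorsAntidiagonal,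
      if (p.1 : ℤ) ∣ n - (k : ℤ) * ((p.1 * p.2 : ℤ) - 1) / 12 then
        chi k p.2 * c ((k : ℤ) * ((p.2 : ℤ) ^ 2 - 1) / 12 +
          p.2 * ((n - (k : ℤ) * ((p.1 * p.2 : ℤ) - 1) / 12) / p.1)) else 0 := by
  have hdiv : (Int.gcd (m : ℤ) (n - (k : ℤ) * ((m : ℤ) - 1) / 12)).divisors
      = m.divisors.filter fun d : ℕ ↦ (d : ℤ) ∣ n - (k : ℤ) * ((m : ℤ) - 1) / 12 := by
    have hm0 : (m : ℤ) ≠ 0 := by omega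
    ext d
    rw [Finset.mem_filter, Nat.mem_divisors, Nat.mem_divisors, Int.dvd_gcd_iff,
      Int.natCast_dvd_natCast]
    have : Int.gcd (m : ℤ) (n - (k : ℤ) * ((m : ℤ) - 1) / 12) ≠ 0 := by
      rw [Ne, Int.gcd_eq_zero_iff]
      exact fun h ↦ hm0 h.1
    constructor
    · rintro ⟨⟨h1, h2⟩, -⟩
      exact ⟨⟨h1, by omega⟩, h2⟩
    · rintro ⟨⟨h1, -⟩, h2⟩
      exact ⟨⟨h1, h2⟩, this⟩
  rw [heckeCoeff, hdiv, Finset.sum_filter, Nat.sum_divisorsAntidiagonal fun a d : ℕ ↦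
    if (a : ℤ) ∣ n - (k : ℤ) * ((a * d : ℤ) - 1) / 12 then
      chi k d * c ((k : ℤ) * ((d : ℤ) ^ 2 - 1) / 12 +
        d * ((n - (k : ℤ) * ((a * d : ℤ) - 1) / 12) / a)) else 0]
  refine Finset.sum_congr rfl fun a ha ↦ ?_
  obtain ⟨d, rfl⟩ := Nat.dvd_of_mem_divisors ha
  have ha0 : 0 < a := Nat.pos_of_mul_pos_right hm
  rw [Nat.mul_div_cancel_left _ ha0]
  push_cast at hkm ⊢
  split_ifs with h
  · obtain ⟨l, hl⟩ := h
    obtain ⟨e, he⟩ := twelve_dvd_mul_sq_sub_one hkm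
    obtain ⟨E, hE⟩ : (12 : ℤ) ∣ k * ((a * d : ℤ) - 1) := by rwa [mul_sub, mul_one]
    rw [hE, Int.mul_ediv_cancel_left _ (by norm_num)] at hl ⊢
    rw [he, Int.mul_ediv_cancel_left _ (by norm_num), hl,
      Int.mul_ediv_cancel_left _ (by exact_mod_cast ha0.ne'), chi_congr hkm,
      ← coeffAt_intCast c (e + d * l)]
    congr 2
    have heQ : (k : ℚ) * (d ^ 2 - 1) = 12 * e := by exact_mod_cast he
    have hEQ : (k : ℚ) * (a * d - 1) = 12 * E := by exact_mod_cast hE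
    have hlQ : (n : ℚ) - E = a * l := by exact_mod_cast hl
    have haQ : (a : ℚ) ≠ 0 := by exact_mod_cast ha0.ne'
    push_cast
    field_simp
    linear_combination 12 * (d : ℚ) * hlQ + a * heQ - d * hEQ
  · rfl

lemma HasFourierCoeffs.heckeOp {k m : ℕ} {R : ℝ} {f : ℍ → ℂ} {c : ℤ → ℂ}
    (hf : HasFourierCoeffs k R f c) (hm : 1 ≤ m) (hkm : (12 : ℤ) ∣ k * m - k) :
    HasFourierCoeffs k R (heckeOp k m f) (heckeCoeff k m c) := by
  intro z
  have hs : (Real.sqrt m : ℂ) ≠ 0 := by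
    have : (0 : ℝ) < m := by exact_mod_cast hm
    exact_mod_cast (Real.sqrt_pos.2 this).ne'
  have key (p : ℕ × ℕ) (hp : p ∈ m.divisorsAntidiagonal) :=
    have hp' := (Nat.mem_divisorsAntidiagonal.1 hp).1
    (hasSum_sum_heckeTerm hf (a := p.1) (d := p.2)
      (Nat.pos_of_mul_pos_right (by omega : 0 < p.1 * p.2))
      (Nat.pos_of_mul_pos_left (by omega : 0 < p.1 * p.2))
      (by rw [← hp'] at hkm; exact_mod_cast hkm) z).mul_left (chi k p.2)
  refine ((hasSum_sum key).mul_left (1 / (Real.sqrt m : ℂ))).congr_fun fun n ↦ ?_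
  rw [heckeCoeff_eq_sum hm hkm, Finset.sum_mul, Finset.mul_sum]
  refine Finset.sum_congr rfl fun p hp ↦ ?_
  have hp' : (p.1 * p.2 : ℝ) = m := by exact_mod_cast (Nat.mem_divisorsAntidiagonal.1 hp).1
  rw [hp']
  split_ifs
  · field_simp
  · simp

end MaassHecke
end

/-! ### Nonvanishing of `W_{κ,iR}` and uniqueness of the coefficient at 0 -/

noncomputable section

namespace MaassHecke

open Filter Topology

lemma norm_ascPochhammer_eval_le (a : ℂ) (n : ℕ) :
    ‖(ascPochhammer ℂ n).eval a‖ ≤ (‖a‖ + 1) ^ n * n.factorial := by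
  induction n with
  | zero => simp
  | succ n ih =>
    rw [ascPochhammer_succ_eval, norm_mul, Nat.factorial_succ]
    have h : ‖a + n‖ ≤ (‖a‖ + 1) * (n + 1) := by
      refine (norm_add_le _ _).trans ?_
      rw [Complex.norm_natCast]
      nlinarith [norm_nonneg a, mul_nonneg (norm_nonneg a) (Nat.cast_nonneg (α := ℝ) n)]
    calc _ ≤ ((‖a‖ + 1) ^ n * n.factorial) * ((‖a‖ + 1) * (n + 1)) := by gcongr
      _ = _ := by push_cast; ring

lemma factorial_le_norm_ascPochhammer_eval {c : ℂ} (hc : 1 ≤ c.re) (n : ℕ) :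
    (n.factorial : ℝ) ≤ ‖(ascPochhammer ℂ n).eval c‖ := by
  induction n with
  | zero => simp
  | succ n ih =>
    rw [ascPochhammer_succ_eval, norm_mul, Nat.factorial_succ]
    have h : (n + 1 : ℝ) ≤ ‖c + n‖ := by
      refine le_trans ?_ (Complex.re_le_norm _)
      simp only [Complex.add_re, Complex.natCast_re]
      linarith
    push_cast
    rw [mul_comm]
    gcongr

lemma kummer_zero (a c : ℂ) : kummer a c 0 = 1 := by
  rw [kummer, tsum_eq_single 0]
  · simp
  · intro n hn
    simp [hn]

/-- For `|x| ≤ 1` the terms are dominated by `(‖a‖+1)^n / n!`. The condition on `c` covers the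
parameters `1 ± 2iR`. -/
lemma tendsto_kummer (a : ℂ) {c : ℂ} (hc : 1 ≤ c.re) :
    Tendsto (kummer a c) (𝓝 0) (𝓝 1) := by
  rw [← kummer_zero a c]
  refine tendsto_tsum_of_dominated_convergence
    (bound := fun n ↦ (‖a‖ + 1) ^ n / n.factorial) (Real.summable_pow_div_factorial _) ?_ ?_
  · intro n
    refine Continuous.tendsto ?_ 0
    fun_prop
  · filter_upwards [Metric.closedBall_mem_nhds (0 : ℝ) one_pos] with x hx n
    rw [Metric.mem_closedBall, dist_zero_right, Real.norm_eq_abs] at hx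
    have h1 := norm_ascPochhammer_eval_le a n
    have h2 := factorial_le_norm_ascPochhammer_eval hc n
    have h3 : (0 : ℝ) < n.factorial := by positivity
    rw [norm_div, norm_mul, norm_div, norm_pow, Complex.norm_natCast, Complex.norm_real,
      Real.norm_eq_abs]
    gcongr
    calc _ ≤ ‖(ascPochhammer ℂ n).eval a‖ / ‖(ascPochhammer ℂ n).eval c‖ * 1 := by
          gcongr
          exact pow_le_one₀ (abs_nonneg x) hx
      _ ≤ (‖a‖ + 1) ^ n * n.factorial / n.factorial := by
          rw [mul_one]
          gcongr
      _ = _ := by field_simp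

lemma whittakerW_eq (κ μ : ℂ) {y : ℝ} (hy : 0 < y) :
    whittakerW κ μ y = Complex.exp (-(y : ℂ) / 2) * (y : ℂ) ^ (-μ + 1 / 2) *
      (Complex.Gamma (-(2 * μ)) / Complex.Gamma (1 / 2 - μ - κ) *
          ((y : ℂ) ^ (2 * μ) * kummer (μ - κ + 1 / 2) (2 * μ + 1) y) +
        Complex.Gamma (2 * μ) / Complex.Gamma (1 / 2 + μ - κ) *
          kummer (-μ - κ + 1 / 2) (2 * -μ + 1) y) := by
  have hy' : (y : ℂ) ≠ 0 := by exact_mod_cast hy.ne'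
  have : (y : ℂ) ^ (μ + 1 / 2) = (y : ℂ) ^ (-μ + 1 / 2) * (y : ℂ) ^ (2 * μ) := by
    rw [← Complex.cpow_add _ _ hy']
    congr 1
    ring
  rw [whittakerW, whittakerM, whittakerM, this]
  ring

/-- As `y → 0`, `W` is a nonzero factor times `A y^{2iR} + B + o(1)`. If `W` vanishes, then `A u + B
= 0` for every value `u` that `y^{2iR}` takes along a sequence tending to `0`. -/
lemma coeff_relation_of_whittakerW_eq_zero {κ R : ℝ}
    (h0 : ∀ y : ℝ, 0 < y → whittakerW κ (Complex.I * R) y = 0) {u : ℂ} {y : ℕ → ℝ}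
    (hpos : ∀ j, 0 < y j) (hlim : Tendsto y atTop (𝓝 0))
    (hu : ∀ j, (y j : ℂ) ^ (2 * (Complex.I * R)) = u) :
    Complex.Gamma (-(2 * (Complex.I * R))) / Complex.Gamma (1 / 2 - Complex.I * R - κ) * u +
      Complex.Gamma (2 * (Complex.I * R)) / Complex.Gamma (1 / 2 + Complex.I * R - κ) = 0 := by
  have h1 := (tendsto_kummer (Complex.I * R - κ + 1 / 2) (c := 2 * (Complex.I * R) + 1)
    (by simp)).comp hlim
  have h2 := (tendsto_kummer (-(Complex.I * R) - κ + 1 / 2) (c := 2 * -(Complex.I * R) + 1)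
    (by simp)).comp hlim
  have h3 := ((h1.const_mul u).const_mul (Complex.Gamma (-(2 * (Complex.I * R))) /
    Complex.Gamma (1 / 2 - Complex.I * R - κ))).add (h2.const_mul
    (Complex.Gamma (2 * (Complex.I * R)) / Complex.Gamma (1 / 2 + Complex.I * R - κ)))
  simp only [mul_one] at h3
  refine tendsto_nhds_unique h3 (tendsto_const_nhds.congr fun j ↦ ?_)
  have h4 := h0 (y j) (hpos j)
  have hy' : (y j : ℂ) ≠ 0 := by exact_mod_cast (hpos j).ne'
  rw [whittakerW_eq _ _ (hpos j), hu, mul_eq_zero] at h4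
  rcases h4 with h4 | h4
  · exact absurd h4 (mul_ne_zero (Complex.exp_ne_zero _) (by simp [Complex.cpow_eq_zero_iff, hy']))
  · exact h4.symm

lemma exists_whittakerW_ne_zero (κ : ℝ) {R : ℝ} (hR : R ≠ 0) :
    ∃ y : ℝ, 0 < y ∧ whittakerW κ (Complex.I * R) y ≠ 0 := by
  by_contra! h0
  -- Here `2R log y = -sign(R)(2πj + θ)`, so `y^{2iR}` is constant along the sequence. The choices
  -- `θ = 0` and `θ = π` give `u = 1` and `u = -1`, whence `B = 0`, while `B` is a quotient of Gamma
  -- values at non-real points.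
  have hseq (θ : ℝ) : Tendsto (fun j : ℕ ↦ Real.exp (-(2 * Real.pi * j + θ) / (2 * |R|)))
      atTop (𝓝 0) := by
    refine Real.tendsto_exp_atBot.comp ?_
    have hR' : 0 < 2 * |R| := by positivity
    refine Tendsto.atBot_div_const hR' (tendsto_neg_atTop_atBot.comp ?_)
    refine tendsto_atTop_add_const_right _ _ ?_
    exact (tendsto_natCast_atTop_atTop).const_mul_atTop Real.two_pi_pos
  have hpow (θ : ℝ) (j : ℕ) :
      ((Real.exp (-(2 * Real.pi * j + θ) / (2 * |R|)) : ℝ) : ℂ) ^ (2 * (Complex.I * R))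
        = Complex.exp (-(SignType.sign R : ℝ) * θ * Complex.I) := by
    have hne : ((Real.exp (-(2 * Real.pi * j + θ) / (2 * |R|)) : ℝ) : ℂ) ≠ 0 := by
      exact_mod_cast (Real.exp_pos _).ne'
    rw [Complex.cpow_def_of_ne_zero hne, ← Complex.ofReal_log (Real.exp_pos _).le, Real.log_exp,
      Complex.exp_eq_exp_iff_exists_int]
    have hRC : (R : ℂ) ≠ 0 := by exact_mod_cast hR
    rcases lt_or_gt_of_ne hR with h | h
    · refine ⟨j, ?_⟩
      rw [abs_of_neg h, sign_neg h]
      push_cast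
      field_simp
      simp
      ring
    · refine ⟨-j, ?_⟩
      rw [abs_of_pos h, sign_pos h]
      push_cast
      field_simp
      simp
  have e1 := coeff_relation_of_whittakerW_eq_zero h0 (fun j ↦ Real.exp_pos _) (hseq 0) (hpow 0)
  have e2 := coeff_relation_of_whittakerW_eq_zero h0 (fun j ↦ Real.exp_pos _) (hseq Real.pi)
    (hpow Real.pi)
  have hpi : Complex.exp (-((SignType.sign R : ℝ) : ℂ) * Real.pi * Complex.I) = -1 := by
    rcases lt_or_gt_of_ne hR with h | h
    · simp [sign_neg h]
    · simp [sign_pos h, Complex.exp_neg]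
  rw [hpi] at e2
  simp only [Complex.ofReal_zero, mul_zero, zero_mul, Complex.exp_zero, mul_one] at e1
  have h3 : Complex.Gamma (2 * (Complex.I * R)) / Complex.Gamma (1 / 2 + Complex.I * R - κ) = 0 := by
    linear_combination (e1 + e2) / 2
  refine div_ne_zero (Complex.Gamma_ne_zero fun n hn ↦ ?_) (Complex.Gamma_ne_zero fun n hn ↦ ?_) h3
  · have := congrArg Complex.im hn
    simp [hR] at this
  · have := congrArg Complex.im hn
    simp [hR] at this

/-- Convergence at `x = 0` already gives absolute summability, so the series may be integrated term
by term over a period. -/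
lemma coeff_zero_of_hasSum_zero {a : ℤ → ℂ}
    (h : ∀ x : ℝ, HasSum (fun n : ℤ ↦ a n * Complex.exp (2 * Real.pi * Complex.I * n * x)) 0) :
    a 0 = 0 := by
  have hs : Summable fun n ↦ ‖a n‖ := by
    have := (h 0).summable.norm
    simpa using this
  have hnorm (n : ℤ) (x : ℝ) : ‖Complex.exp (2 * Real.pi * Complex.I * n * x)‖ = 1 := by
    rw [show 2 * Real.pi * Complex.I * n * x = ((2 * Real.pi * n * x : ℝ) : ℂ) * Complex.I by
      push_cast; ring, Complex.norm_exp_ofReal_mul_I]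
  have h1 := intervalIntegral.hasSum_integral_of_dominated_convergence (μ := volume)
    (a := (0 : ℝ)) (b := 1)
    (F := fun (n : ℤ) (x : ℝ) ↦ a n * Complex.exp (2 * Real.pi * Complex.I * n * x))
    (f := fun _ ↦ 0) (fun n _ ↦ ‖a n‖) (fun n ↦ by
      refine Continuous.aestronglyMeasurable ?_
      fun_prop) (fun n ↦ .of_forall fun x _ ↦ by rw [norm_mul, hnorm, mul_one])
    (.of_forall fun _ _ ↦ hs) intervalIntegrable_const (.of_forall fun x _ ↦ h x)
  have h2 (n : ℤ) (hn : n ≠ 0) :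
      ∫ x in (0 : ℝ)..1, a n * Complex.exp (2 * Real.pi * Complex.I * n * x) = 0 := by
    have hn' : 2 * Real.pi * Complex.I * n ≠ 0 :=
      mul_ne_zero Complex.two_pi_I_ne_zero (by exact_mod_cast hn)
    have h3 : Complex.exp (2 * Real.pi * Complex.I * n) = 1 := by
      rw [Complex.exp_eq_one_iff]
      exact ⟨n, by ring⟩
    rw [intervalIntegral.integral_const_mul, integral_exp_mul_complex hn']
    simp [h3]
  have h3 := h1.unique (hasSum_single 0 h2)
  simpa using h3.symm

lemma HasFourierCoeffs.zero_coeff_eq {k : ℕ} (hk : 1 ≤ k) {R : ℝ} (hR : R ≠ 0) {f : ℍ → ℂ}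
    {c c' : ℤ → ℂ} (h : HasFourierCoeffs k R f c) (h' : HasFourierCoeffs k R f c') :
    c 0 = c' 0 := by
  have hs : (0 : ℝ) < k / 12 := by positivity
  obtain ⟨y, hy, hW⟩ := exists_whittakerW_ne_zero ((k : ℝ) / 2 * Real.sign (k / 12)) hR
  -- The height at which the Whittaker argument of the `n = 0` wave equals `y`.
  set y' : ℝ := y / (4 * Real.pi * (k / 12)) with hy'
  have hpos : 0 < y' := by positivity
  have key : (c 0 - c' 0) * (1 / (Real.sqrt |((0 : ℤ) : ℝ) + k / 12| : ℂ) *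
      whittakerW (((k : ℝ) / 2 * Real.sign (((0 : ℤ) : ℝ) + k / 12) : ℝ) : ℂ) (Complex.I * R)
        (4 * Real.pi * |((0 : ℤ) : ℝ) + k / 12| * y')) = 0 := by
    refine coeff_zero_of_hasSum_zero (a := fun n ↦ (c n - c' n) *
      (1 / (Real.sqrt |(n : ℝ) + k / 12| : ℂ) *
      whittakerW (((k : ℝ) / 2 * Real.sign ((n : ℝ) + k / 12) : ℝ) : ℂ) (Complex.I * R)
        (4 * Real.pi * |(n : ℝ) + k / 12| * y'))) fun x ↦ ?_
    -- Multiplying by `e(-kx/12)` turns the frequencies `n + k/12` into integers.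
    have h1 := ((h ⟨⟨x, y'⟩, hpos⟩).sub (h' ⟨⟨x, y'⟩, hpos⟩)).mul_right
      (Complex.exp (-(2 * Real.pi * Complex.I * (k / 12) * x)))
    rw [sub_self, zero_mul] at h1
    refine h1.congr_fun fun n ↦ ?_
    have h2 : Complex.exp (2 * Real.pi * Complex.I * n * x) =
        Complex.exp (2 * Real.pi * Complex.I * ((n + k / 12 : ℝ) : ℂ) * x) *
          Complex.exp (-(2 * Real.pi * Complex.I * (k / 12) * x)) := by
      rw [← Complex.exp_add]
      congr 1
      push_cast
      ring
    rw [h2]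
    change _ = (c n * (_ * whittakerW _ _ (4 * Real.pi * |(n : ℝ) + k / 12| * y') *
      Complex.exp (2 * Real.pi * Complex.I * ((n + k / 12 : ℝ) : ℂ) * x)) -
      c' n * (_ * whittakerW _ _ (4 * Real.pi * |(n : ℝ) + k / 12| * y') *
      Complex.exp (2 * Real.pi * Complex.I * ((n + k / 12 : ℝ) : ℂ) * x))) * _
    ring
  rw [Int.cast_zero, zero_add, abs_of_pos hs,
    show 4 * Real.pi * (k / 12 : ℝ) * y' = y by rw [hy']; field_simp] at key
  have hsq : (1 : ℂ) / (Real.sqrt (k / 12) : ℂ) ≠ 0 :=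
    one_div_ne_zero (by exact_mod_cast (Real.sqrt_pos.2 hs).ne')
  exact sub_eq_zero.1 ((mul_eq_zero.1 key).resolve_right (mul_ne_zero hsq hW))

/-! ### The divisors occurring in `d(0)` -/

lemma exists_eq_mul_add_one {k m : ℕ} (hk1 : 1 ≤ k) (hk2 : k ≤ 11)
    (hkm : (12 : ℤ) ∣ k * m - k) :
    ∃ N t : ℤ, (m : ℤ) = N * t + 1 ∧ (k : ℤ) * ((m : ℤ) - 1) / 12 = bigD k * t := by
  refine ⟨12 / Nat.gcd 12 k, (m - 1) / (12 / Nat.gcd 12 k), ?_⟩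
  interval_cases k <;> norm_num [bigD] at hkm ⊢ <;> omega

/-- With `N = 12/gcd(12,k)` one has `m = Nt + 1` and `k(m-1)/12 = Dt`. The factor `t` is coprime to
`m`, so only `D` matters. -/
lemma gcd_shift_eq {k m : ℕ} (hk1 : 1 ≤ k) (hk2 : k ≤ 11) (hkm : (12 : ℤ) ∣ k * m - k) :
    Int.gcd (m : ℤ) (0 - (k : ℤ) * ((m : ℤ) - 1) / 12) = Nat.gcd (bigD k) m := by
  obtain ⟨N, t, h1, h2⟩ := exists_eq_mul_add_one hk1 hk2 hkm
  have hco : IsCoprime (m : ℤ) t := ⟨1, -N, by rw [h1]; ring⟩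
  rw [h2, zero_sub, Int.gcd_neg, Int.gcd_mul_left_right_of_gcd_eq_one, Int.gcd_natCast_natCast,
    Nat.gcd_comm]
  exact Int.isCoprime_iff_gcd_eq_one.1 hco

/-- This is why the eigenvalue formula has just two cases: the divisors of `gcd(D, m)` are `1`
alone, or `1` and `D`. -/
lemma bigD_eq_one_or_prime {k : ℕ} (hk1 : 1 ≤ k) (hk2 : k ≤ 11) :
    bigD k = 1 ∨ (bigD k).Prime := by
  interval_cases k <;> norm_num [bigD]

lemma heckeCoeff_zero {k m : ℕ} (hk1 : 1 ≤ k) (hk2 : k ≤ 11) (hkm : (12 : ℤ) ∣ k * m - k)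
    (c : ℤ → ℂ) :
    heckeCoeff k m c 0 = ∑ d ∈ (Nat.gcd (bigD k) m).divisors,
      chi k d * coeffAt c ((k : ℚ) * (m - (d : ℚ) ^ 2) / (12 * (d : ℚ) ^ 2)) := by
  rw [heckeCoeff, gcd_shift_eq hk1 hk2 hkm]
  simp

lemma heckeCoeff_zero_of_coprime {k m : ℕ} (hk1 : 1 ≤ k) (hk2 : k ≤ 11)
    (hkm : (12 : ℤ) ∣ k * m - k) (c : ℤ → ℂ) (h : Nat.Coprime (bigD k) m) :
    heckeCoeff k m c 0 = coeffAt c ((k : ℚ) * ((m : ℚ) - 1) / 12) := by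
  rw [heckeCoeff_zero hk1 hk2 hkm, h]
  simp [chi]

lemma heckeCoeff_zero_of_one_lt_gcd {k m : ℕ} (hk1 : 1 ≤ k) (hk2 : k ≤ 11)
    (hkm : (12 : ℤ) ∣ k * m - k) (c : ℤ → ℂ) (h : 1 < Nat.gcd (bigD k) m) :
    heckeCoeff k m c 0 = coeffAt c ((k : ℚ) * ((m : ℚ) - 1) / 12) +
      chi k (bigD k) * coeffAt c ((k : ℚ) * ((m : ℚ) - (bigD k : ℚ) ^ 2) /
        (12 * (bigD k : ℚ) ^ 2)) := by
  have hp : (bigD k).Prime := by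
    refine (bigD_eq_one_or_prime hk1 hk2).resolve_left fun h1 ↦ ?_
    simp [h1] at h
  have hg : Nat.gcd (bigD k) m = bigD k :=
    ((Nat.dvd_prime hp).1 (Nat.gcd_dvd_left _ _)).resolve_left h.ne'
  rw [heckeCoeff_zero hk1 hk2 hkm, hg, hp.divisors, Finset.sum_pair hp.one_lt.ne]
  simp [chi]

end MaassHecke
end

theorem mainTheorem2 (k : ℕ) (hk1 : 1 ≤ k) (hk2 : k ≤ 11) (R : ℝ)
    (hR : (1 : ℝ) / 4 < 1 / 4 + R ^ 2) (m : ℕ) (hm : 1 ≤ m) (hkm : k * m ≡ k [MOD 12]) :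
    (∀ f ∈ MaassHecke.maassSpace k R, ∀ a d : ℕ, a * d = m → ∀ b b' : ℤ, b ≡ b' [ZMOD d] →
      ∀ z : UpperHalfPlane,
        MaassHecke.heckeTerm k f a d b z = MaassHecke.heckeTerm k f a d b' z) ∧
    ∃ T : MaassHecke.maassSpace k R →ₗ[ℂ] MaassHecke.maassSpace k R,
      (∀ f : MaassHecke.maassSpace k R,
        (T f : UpperHalfPlane → ℂ) = MaassHecke.heckeOp k m (f : UpperHalfPlane → ℂ)) ∧
      (∀ (f : MaassHecke.maassSpace k R) (c : ℤ → ℂ),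
        MaassHecke.HasFourierCoeffs k R (f : UpperHalfPlane → ℂ) c →
        MaassHecke.HasFourierCoeffs k R (T f : UpperHalfPlane → ℂ)
          (MaassHecke.heckeCoeff k m c)) ∧
      (∀ (f : MaassHecke.maassSpace k R) (c : ℤ → ℂ) (lam : ℂ),
        MaassHecke.HasFourierCoeffs k R (f : UpperHalfPlane → ℂ) c →
        T f = lam • f → c 0 ≠ 0 →
        (Nat.Coprime (MaassHecke.bigD k) m →
          lam = 1 / c 0 * MaassHecke.coeffAt c ((k : ℚ) * ((m : ℚ) - 1) / 12)) ∧
        (1 < Nat.gcd (MaassHecke.bigD k) m →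
          lam = 1 / c 0 * (MaassHecke.coeffAt c ((k : ℚ) * ((m : ℚ) - 1) / 12) +
            MaassHecke.chi k (MaassHecke.bigD k) *
              MaassHecke.coeffAt c ((k : ℚ) * ((m : ℚ) - (MaassHecke.bigD k : ℚ) ^ 2) /
                (12 * (MaassHecke.bigD k : ℚ) ^ 2))))) := by
  have hkm' : (12 : ℤ) ∣ k * m - k := by
    have := (Nat.modEq_iff_dvd.1 hkm.symm)
    exact_mod_cast this
  have hR0 : R ≠ 0 := by
    rintro rfl
    norm_num at hR
  refine ⟨fun f hf a d had b b' hb z ↦ ?_, ?_⟩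
  · subst had
    exact MaassHecke.heckeTerm_congr hf.2.1 (Nat.pos_of_mul_pos_right hm)
      (Nat.pos_of_mul_pos_left hm) (by exact_mod_cast hkm') hb z
  let T : MaassHecke.maassSpace k R →ₗ[ℂ] MaassHecke.maassSpace k R :=
    { toFun := fun f ↦ ⟨MaassHecke.heckeOp k m f, MaassHecke.heckeOp_mem hm hkm' f.2⟩
      map_add' := fun f g ↦ Subtype.ext (funext fun z ↦ by
        simp only [MaassHecke.heckeOp, MaassHecke.heckeTerm, Submodule.coe_add, Pi.add_apply,
          mul_add, Finset.sum_add_distrib])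
      map_smul' := fun a f ↦ Subtype.ext (funext fun z ↦ by
        simp only [MaassHecke.heckeOp, MaassHecke.heckeTerm, SetLike.val_smul, Pi.smul_apply,
          smul_eq_mul, Finset.mul_sum, RingHom.id_apply, mul_left_comm _ a]) }
  refine ⟨T, fun f ↦ rfl, fun f c hc ↦ hc.heckeOp hm hkm', fun f c lam hc hT h0 ↦ ?_⟩
  have h1 : MaassHecke.HasFourierCoeffs k R (T f : UpperHalfPlane → ℂ)
      (MaassHecke.heckeCoeff k m c) := hc.heckeOp hm hkm'
  have h2 : MaassHecke.HasFourierCoeffs k R (T f : UpperHalfPlane → ℂ) fun n ↦ lam * c n := by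
    intro z
    rw [hT]
    exact ((hc z).mul_left lam).congr_fun fun n ↦ mul_assoc _ _ _
  have h3 : MaassHecke.heckeCoeff k m c 0 = lam * c 0 := h1.zero_coeff_eq hk1 hR0 h2
  refine ⟨fun h ↦ ?_, fun h ↦ ?_⟩
  · rw [← MaassHecke.heckeCoeff_zero_of_coprime hk1 hk2 hkm' c h, h3]
    field_simp
  · rw [← MaassHecke.heckeCoeff_zero_of_one_lt_gcd hk1 hk2 hkm' c h, h3]
    field_simp
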